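/- **Setting.** Let $P$ be the law of $(x,y)\in\mathbb{R}^p\times\mathbb{R}$, with finite second moments, and let $\beta\in\mathbb{R}^p$ be such that, with $u=y-x^T\beta$: $\mathbb{E}[u\,x_j]=0$ for all $j$, and no $x_i$ with $\beta_i\neq0$ is almost surely a linear combination of the other coordinates of $x$. An i.i.d. sample from $P$ is split into $K\ge2$ folds of size $n_s\ge1$; the $q$-th test set $(X_s^q,Y_s^q)$ is fold $q$, the $q$-th training set $(X_t^q,Y_t^q)$ consists of the other $K-1$ folds, and $n_t=(K-1)n_s$, $\widetilde n=\min\{n_s,n_t\}$. Write $\mathcal{R}(b)=\mathbb{E}(y-x^Tb)^2$, and $\mathcal{R}_{n}(b|X,Y)=\frac1n\|Y-Xb\|_2^2$ for a sample of size $n$. Let $b^k_{train}$ be an OLS estimator on the $k$-th training set, let $(k^*,q^*)$ maximize $\mathcal{R}_{n_s}(b^k_{train}|X_s^q,Y_s^q)$ over all $k,q\in\{1,\dots,K\}$, and put $\bar b_{train}=b_{train}^{k^*}$, $\overline{e_t}=Y_t^{q^*}-X_t^{q^*}\bar b_{train}$, $\overline{e_s^q}=Y_s^q-X_s^q\bar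 b_{train}$. Let $\Lambda\subseteq[0,\infty)$ be a set of penalties with $0\in\Lambda$ and let $T\ni k^*$ be a set of indices of training sets. The cross-validated Lasso $b_{Lasso}$ minimizes $\frac1K\sum_{q}\mathcal{R}_{n_s}(b|X_s^q,Y_s^q)$ among all minimizers $b$ of $\frac1{n_t}\|Y_t^k-X_t^kb\|_2^2+\lambda\|b\|_1$ with $\lambda\in\Lambda$, $k\in T$. For $r>1$ let $\tau>0$ be such that $\big(\mathbb{E}|y-x^Tb|^{2r}\big)^{1/r}\le\tau\,\mathcal{R}(b)$ for all $b\in\mathbb{R}^p$. Let $\bar\rho$ be the smallest of the minimal eigenvalues of the matrices $\frac1{n_s}(X_s^k)^TX_s^k$, $k=1,\dots,K$, and for $\varpi\in(0,1)$ let $$\bar\epsilon=\frac1{n_t}\Big[p\ln\frac{n_t}{p}+p+\ln n_t\Big],\qquad \bar\varsigma=\frac{2^{1/r}\,\tau\,\mathcal{R}(\bar b_{train})}{(1-\varpi)^{1/r}\,n_s^{1-1/r}}.$$ **(1) Bound.** If $n_t\ge p$, then with probability at least $\varpi(1-1/n_t)$ the following holds whenever $\bar\rho>0$: $$\frac1K\sum_{q=1}^K\|\bar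 b_{train}-b_{Lasso}\|_2^2\le\left|\frac{1}{n_t\bar\rho}\frac{\|\overline{e_t}\|_2^2}{1-\sqrt{\bar\epsilon}}-\frac1K\sum_{q=1}^K\frac{1}{n_s\bar\rho}\|\overline{e_s^q}\|_2^2\right|+\frac1K\sum_{q=1}^K\frac{4}{n_s\bar\rho}\big\|(\overline{e_s^q})^TX_s^q\big\|_\infty\|\bar b_{train}\|_1+\frac{\bar\varsigma}{\bar\rho},$$ for $b_{Lasso}$ with $T=\{k^*\}$ (Lasso path on the worst-case training set), and also for any other $T\ni k^*$ for which $\|b_{Lasso}\|_1\le\|\bar b_{train}\|_1$. **(2) Consistency.** Consider a sequence of such problems in which $p$, $K$, $n_s$, $P$, $\beta$, $\Lambda$ may all vary with $n$, with $r>1$ and $\tau$ fixed, with $\mathbb{E}u^2$ bounded, and with the smallest eigenvalue of $\mathbb{E}[xx^T]$ bounded away from zero. If $p/\widetilde n\to0$, then both the OLS estimator and the cross-validated Lasso (for every $T\ni k^*$) converge to the true parameter: $\|\bar b_{train}-\beta\|_2\to0$ and $\|b_{Lasso}-\beta\|_2\to0$ in probability. -/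

import Mathlib

open MeasureTheory Filter Topology

noncomputable section

namespace CVLasso

/-- An observation `(x, y)`: a covariate vector `x ∈ ℝ^p` and a response `y ∈ ℝ`. -/
abbrev Obs (p : ℕ) : Type := EuclideanSpace ℝ (Fin p) × ℝ

/-! ### Population quantities -/

/-- Squared loss `(y - xᵀ b)²` of the linear prediction with coefficient vector `b`. -/
def loss {p : ℕ} (b : EuclideanSpace ℝ (Fin p)) (z : Obs p) : ℝ :=
  (z.2 - inner ℝ z.1 b) ^ 2

/-- Population risk `R(b) = ∫ Loss dF` (the loss is integrable under `LinearDGP` below). -/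
def popRisk {p : ℕ} (P : Measure (Obs p)) (b : EuclideanSpace ℝ (Fin p)) : ℝ :=
  ∫ z, loss b z ∂P

/-- The law `P` of `(x, y)` follows the linear model `y = xᵀ β + u`, where `u = y - xᵀ β` is
uncorrelated with the covariates (`exogenous`) and no covariate with a non-zero coefficient is a
linear combination of the other ones (`unique`).  Second moments are finite. -/
structure LinearDGP {p : ℕ} (P : Measure (Obs p)) (β : EuclideanSpace ℝ (Fin p)) : Prop where
  isProb : IsProbabilityMeasure P
  memLp_x : MemLp (fun z : Obs p => z.1) 2 P
  memLp_y : MemLp (fun z : Obs p => z.2) 2 P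
  exogenous : ∀ j : Fin p, ∫ z, (z.2 - inner ℝ z.1 β) * z.1 j ∂P = 0
  unique : ∀ i : Fin p, β i ≠ 0 → ∀ a : Fin p → ℝ, a i = 0 →
    ¬ ∀ᵐ z ∂P, z.1 i = ∑ j, a j * z.1 j

/-- `τ ≥ sup_b (∫ Loss(b)^r dF)^(1/r) / ∫ Loss(b) dF`, written without division. -/
def LossRatioBound {p : ℕ} (P : Measure (Obs p)) (r τ : ℝ) : Prop :=
  ∀ b : EuclideanSpace ℝ (Fin p),
    eLpNorm (loss b) (ENNReal.ofReal r) P ≤ ENNReal.ofReal τ * ENNReal.ofReal (popRisk P b)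

/-! ### Sample quantities, for a finite sample `D` indexed by `ι` -/

section Sample

variable {p : ℕ} {ι : Type*} [Fintype ι]

/-- The `ℓ¹` norm of a coefficient vector. -/
def l1Norm (b : EuclideanSpace ℝ (Fin p)) : ℝ := ∑ j, |b j|

/-- The design matrix `X`. -/
def design (D : ι → Obs p) : Matrix ι (Fin p) ℝ := Matrix.of fun i j => (D i).1 j

/-- The residual vector `Y - X b`. -/
def residual (D : ι → Obs p) (b : EuclideanSpace ℝ (Fin p)) : EuclideanSpace ℝ ι :=
  WithLp.toLp 2 fun i => (D i).2 - inner ℝ (D i).1 b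

/-- Empirical risk `(1/n) ‖Y - X b‖₂²`. -/
def empRisk (D : ι → Obs p) (b : EuclideanSpace ℝ (Fin p)) : ℝ :=
  1 / (Fintype.card ι : ℝ) * ‖residual D b‖ ^ 2

/-- `‖(Y - X b)ᵀ X‖_∞` (the norm of `Fin p → ℝ` is the maximum norm). -/
def scoreSup (D : ι → Obs p) (b : EuclideanSpace ℝ (Fin p)) : ℝ :=
  ‖(Matrix.vecMul (residual D b).ofLp (design D) : Fin p → ℝ)‖

/-- `b` is an OLS estimator on `D`. -/
def IsOLS (D : ι → Obs p) (b : EuclideanSpace ℝ (Fin p)) : Prop :=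
  ∀ b', empRisk D b ≤ empRisk D b'

/-- `b` is a Lasso estimator on `D` with penalty `pen`. -/
def IsLasso (D : ι → Obs p) (pen : ℝ) (b : EuclideanSpace ℝ (Fin p)) : Prop :=
  ∀ b', empRisk D b + pen * l1Norm b ≤ empRisk D b' + pen * l1Norm b'

/-- The normalized Gram matrix `(1/n) Xᵀ X`. -/
def gram (D : ι → Obs p) : Matrix (Fin p) (Fin p) ℝ :=
  (1 / (Fintype.card ι : ℝ)) • ((design D).transpose * design D)

theorem gram_isHermitian (D : ι → Obs p) : (gram D).IsHermitian := by
  unfold gram Matrix.IsHermitian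
  simp [Matrix.conjTranspose_eq_transpose_of_trivial]

/-- The minimal eigenvalue of the normalized Gram matrix. -/
def minEig (D : ι → Obs p) : ℝ := ⨅ i : Fin p, (gram_isHermitian D).eigenvalues i

end Sample

/-! ### Cross-validation: `K` folds of `m` observations each -/

section CV

variable {p K m : ℕ}

/-- The `q`-th test set: the observations of fold `q`. -/
def testSet (d : Fin K × Fin m → Obs p) (q : Fin K) : Fin m → Obs p := fun i => d (q, i)

/-- The `q`-th training set: the observations of all folds but `q`. -/
def trainSet (d : Fin K × Fin m → Obs p) (q : Fin K) : {k : Fin K // k ≠ q} × Fin m → Obs p :=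
  fun i => d (i.1.1, i.2)

/-- Size `n_t` of each training set. -/
def trainSize (K m : ℕ) : ℕ := (K - 1) * m

/-- Generalization error averaged over the `K` test sets. -/
def cvError (d : Fin K × Fin m → Obs p) (b : EuclideanSpace ℝ (Fin p)) : ℝ :=
  1 / (K : ℝ) * ∑ q, empRisk (testSet d q) b

/-- `bt k` is the OLS estimator on the `k`-th training set for all `k`, and `(ks, qs)` attains the
worst case: it maximizes over `(k, q)` the error of `bt k` on the `q`-th test set. -/
def IsWorstCase (d : Fin K × Fin m → Obs p) (bt : Fin K → EuclideanSpace ℝ (Fin p))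
    (ks qs : Fin K) : Prop :=
  (∀ k, IsOLS (trainSet d k) (bt k)) ∧
    ∀ k q, empRisk (testSet d q) (bt k) ≤ empRisk (testSet d qs) (bt ks)

/-- `b` is a cross-validated Lasso estimator: among the Lasso estimators with penalties in `Pen`
computed on the training sets with index in `T`, it has minimal averaged generalization error. -/
def IsCVLasso (d : Fin K × Fin m → Obs p) (Pen : Set ℝ) (T : Set (Fin K))
    (b : EuclideanSpace ℝ (Fin p)) : Prop :=
  (∃ k ∈ T, ∃ pen ∈ Pen, IsLasso (trainSet d k) pen b) ∧
    ∀ k ∈ T, ∀ pen ∈ Pen, ∀ b', IsLasso (trainSet d k) pen b' → cvError d b ≤ cvError d b'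

/-- The minimal eigenvalue over all test-set Gram matrices. -/
def rhoBar (d : Fin K × Fin m → Obs p) : ℝ := ⨅ q : Fin K, minEig (testSet d q)

/-- `ε = (1/n) [h ln(n/h) + h - ln η]`. -/
def vcEps (h n : ℕ) (η : ℝ) : ℝ :=
  1 / (n : ℝ) * (h * Real.log ((n : ℝ) / h) + h - Real.log η)

/-- `ς = 2^(1/r) τ E[Loss(b)] / ((1 - ϖ)^(1/r) n_s^(1 - 1/r))`. -/
def varsigma (P : Measure (Obs p)) (r τ ϖ : ℝ) (ns : ℕ) (b : EuclideanSpace ℝ (Fin p)) : ℝ :=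
  (2 : ℝ) ^ (1 / r) * τ * popRisk P b / ((1 - ϖ) ^ (1 / r) * (ns : ℝ) ^ (1 - 1 / r))

/-- Right-hand side of the bound for the worst-case OLS estimator `b` and the worst-case test set
`qs`, with VC dimension `h = p` and `η = 1 / n_t`. -/
def cvBound (P : Measure (Obs p)) (r τ ϖ : ℝ) (d : Fin K × Fin m → Obs p) (qs : Fin K)
    (b : EuclideanSpace ℝ (Fin p)) : ℝ :=
  |1 / (trainSize K m * rhoBar d) *
        (‖residual (trainSet d qs) b‖ ^ 2 /
          (1 - √(vcEps p (trainSize K m) (1 / trainSize K m))))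
      - 1 / (K : ℝ) * ∑ q, 1 / (m * rhoBar d) * ‖residual (testSet d q) b‖ ^ 2|
    + 1 / (K : ℝ) * ∑ q, 4 / (m * rhoBar d) * scoreSup (testSet d q) b * l1Norm b
    + varsigma P r τ ϖ m b / rhoBar d

/-- The law of an i.i.d. sample from `P`, arranged in `K` folds of size `m`. -/
def sampleLaw (P : Measure (Obs p)) (K m : ℕ) : Measure (Fin K × Fin m → Obs p) :=
  Measure.pi fun _ => P

end CV

end CVLasso

end

noncomputable section

namespace CVLasso

/-! ### Empirical risks and their quadratic expansion -/

section SampleAlgebra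

variable {p : ℕ} {ι : Type*} [Fintype ι]

/-! The finite-sample bound is deterministic once `rhoBar` is positive. Penalty 0 makes the
worst-case OLS estimator a competitor of the Lasso, so the Lasso has no larger cross-validation
error. That criterion is a quadratic with curvature at least `rhoBar`; hence the squared distance is
governed by the linear term at OLS, which ℓ¹–ℓ∞ duality bounds by the score times the ℓ¹ norm of the
difference, itself at most twice that of OLS. The score term of `cvBound` alone suffices, and its
other terms are nonnegative.

For consistency, a linear change of coordinates makes the design isotropic and moves the true
parameter to 0 (`isotropic_whiten`). Only moments of the loss of order r > 1 are available, so upper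
bounds on Gram matrices and fourth moments are out of reach. Three devices replace them.

Lower bound on the Gram matrix (`exists_gram_lower`): the moment comparison gives a small-ball
condition, hence an exponentially small lower tail in each fixed direction. Uniformity over
directions is volumetric: a single bad direction forces a set of bad directions of volume at least
about (ρ/2)^p relative to a fixed ball, while the expected relative volume is exponentially small in
m.

Score: the vector u x is truncated. The truncated sum has a second moment of order m p plus a small
bias, and the remainder is paired with the empirical norm by Cauchy–Schwarz. Measuring the score in
the empirical norm (`Controlled`) avoids any upper bound on the Gram matrix.

Many folds: K may grow, so no union bound over the Gram events of the folds is possible. Markov's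
inequality still leaves fewer than half of the folds bad, which controls the full sample and every
training set at once (`controlled_of_folds`). On the omitted fold, independence from the training
set gives an error probability of order 1/K at the scale of the full sample, and this does survive a
union over k (`sampleLaw_testSet_error_le`). OLS is then small on the full sample, and so is
anything with no larger cross-validation error, in particular the Lasso. -/

theorem norm_residual_sq (D : ι → Obs p) (b : EuclideanSpace ℝ (Fin p)) :
    ‖residual D b‖ ^ 2 = ∑ i, ((D i).2 - inner ℝ (D i).1 b) ^ 2 := by
  rw [EuclideanSpace.real_norm_sq_eq]; rfl

theorem empRisk_eq (D : ι → Obs p) (b : EuclideanSpace ℝ (Fin p)) :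
    empRisk D b = 1 / (Fintype.card ι : ℝ) * ∑ i, ((D i).2 - inner ℝ (D i).1 b) ^ 2 := by
  rw [empRisk, norm_residual_sq]

theorem sum_sq_residual_add (D : ι → Obs p) (b v : EuclideanSpace ℝ (Fin p)) :
    ∑ i, ((D i).2 - inner ℝ (D i).1 (b + v)) ^ 2 =
      ∑ i, ((D i).2 - inner ℝ (D i).1 b) ^ 2
        - 2 * ∑ i, ((D i).2 - inner ℝ (D i).1 b) * inner ℝ (D i).1 v
        + ∑ i, (inner ℝ (D i).1 v) ^ 2 := by
  rw [Finset.mul_sum, ← Finset.sum_sub_distrib, ← Finset.sum_add_distrib]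
  refine Finset.sum_congr rfl fun i _ => ?_
  rw [inner_add_right]; ring

theorem IsOLS.sum_sq_le [Nonempty ι] {D : ι → Obs p} {b : EuclideanSpace ℝ (Fin p)}
    (h : IsOLS D b) (b' : EuclideanSpace ℝ (Fin p)) :
    ∑ i, ((D i).2 - inner ℝ (D i).1 b) ^ 2 ≤ ∑ i, ((D i).2 - inner ℝ (D i).1 b') ^ 2 := by
  have := h b'
  rw [empRisk_eq, empRisk_eq] at this
  exact le_of_mul_le_mul_left this (by positivity)

/-- The normal equations of least squares. -/
theorem IsOLS.normal_eq [Nonempty ι] {D : ι → Obs p} {b : EuclideanSpace ℝ (Fin p)}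
    (h : IsOLS D b) (v : EuclideanSpace ℝ (Fin p)) :
    ∑ i, ((D i).2 - inner ℝ (D i).1 b) * inner ℝ (D i).1 v = 0 := by
  set A := ∑ i, ((D i).2 - inner ℝ (D i).1 b) * inner ℝ (D i).1 v with hA
  set B := ∑ i, (inner ℝ (D i).1 v) ^ 2 with hB
  have key : ∀ t : ℝ, 0 ≤ B * (t * t) + (-2 * A) * t + 0 := by
    intro t
    have h1 := h.sum_sq_le (b + t • v)
    rw [sum_sq_residual_add] at h1
    have h2 : ∑ i, ((D i).2 - inner ℝ (D i).1 b) * inner ℝ (D i).1 (t • v) = t * A := by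
      rw [hA, Finset.mul_sum]
      refine Finset.sum_congr rfl fun i _ => ?_
      rw [inner_smul_right]; ring
    have h3 : ∑ i, (inner ℝ (D i).1 (t • v)) ^ 2 = t ^ 2 * B := by
      rw [hB, Finset.mul_sum]
      refine Finset.sum_congr rfl fun i _ => ?_
      rw [inner_smul_right]; ring
    rw [h2, h3] at h1
    nlinarith
  -- A quadratic in t without constant term is nonnegative everywhere only if its linear coefficient
  -- vanishes: the discriminant is 4 A².
  have := discrim_le_zero key
  unfold discrim at this
  nlinarith [sq_nonneg A]

theorem IsOLS.eq_of_definite [Nonempty ι] {D : ι → Obs p} {b b' : EuclideanSpace ℝ (Fin p)}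
    (h : IsOLS D b) (h' : IsOLS D b')
    (hD : ∀ v, ∑ i, (inner ℝ (D i).1 v) ^ 2 = 0 → v = 0) : b' = b := by
  have h1 := sum_sq_residual_add D b (b' - b)
  rw [h.normal_eq, add_sub_cancel] at h1
  have h2 := h'.sum_sq_le b
  have h3 : ∑ i, (inner ℝ (D i).1 (b' - b)) ^ 2 = 0 :=
    le_antisymm (by linarith) (Finset.sum_nonneg fun i _ => sq_nonneg _)
  exact sub_eq_zero.mp (hD _ h3)

theorem isLasso_zero {D : ι → Obs p} {b : EuclideanSpace ℝ (Fin p)} :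
    IsLasso D 0 b ↔ IsOLS D b := by
  simp [IsLasso, IsOLS]

theorem l1Norm_nonneg (b : EuclideanSpace ℝ (Fin p)) : 0 ≤ l1Norm b :=
  Finset.sum_nonneg fun _ _ => abs_nonneg _

theorem l1Norm_sub_le (b b' : EuclideanSpace ℝ (Fin p)) :
    l1Norm (b - b') ≤ l1Norm b + l1Norm b' := by
  unfold l1Norm
  rw [← Finset.sum_add_distrib]
  exact Finset.sum_le_sum fun j _ => by simpa using abs_sub (b j) (b' j)

/-- A Lasso estimator has at most the `ℓ¹` norm of a least squares estimator. -/
theorem IsLasso.l1Norm_le {D : ι → Obs p} {pen : ℝ} {b b₀ : EuclideanSpace ℝ (Fin p)}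
    (hpen : 0 < pen) (h : IsLasso D pen b) (h₀ : IsOLS D b₀) : l1Norm b ≤ l1Norm b₀ := by
  have h1 := h b₀
  have h2 := h₀ b
  exact le_of_mul_le_mul_left (by linarith) hpen

theorem abs_sum_residual_mul_le (D : ι → Obs p) (b v : EuclideanSpace ℝ (Fin p)) :
    |∑ i, ((D i).2 - inner ℝ (D i).1 b) * inner ℝ (D i).1 v| ≤ scoreSup D b * l1Norm v := by
  have h1 : ∑ i, ((D i).2 - inner ℝ (D i).1 b) * inner ℝ (D i).1 v =
      ∑ j, Matrix.vecMul (residual D b).ofLp (design D) j * v j := by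
    simp only [Matrix.vecMul, dotProduct, Finset.sum_mul]
    rw [Finset.sum_comm]
    refine Finset.sum_congr rfl fun i _ => ?_
    simp only [PiLp.inner_apply, design, residual, Matrix.of_apply, Finset.mul_sum]
    refine Finset.sum_congr rfl fun j _ => ?_
    simp; ring
  rw [h1, l1Norm, Finset.mul_sum]
  refine (Finset.abs_sum_le_sum_abs _ _).trans (Finset.sum_le_sum fun j _ => ?_)
  rw [abs_mul]
  exact mul_le_mul_of_nonneg_right
    (norm_le_pi_norm (Matrix.vecMul (residual D b).ofLp (design D)) j) (abs_nonneg _)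

theorem inner_gram_eq (D : ι → Obs p) (v : EuclideanSpace ℝ (Fin p)) :
    v.ofLp ⬝ᵥ (gram D).mulVec v.ofLp =
      1 / (Fintype.card ι : ℝ) * ∑ i, (inner ℝ (D i).1 v) ^ 2 := by
  rw [gram, Matrix.smul_mulVec, dotProduct_smul, smul_eq_mul, ← Matrix.mulVec_mulVec,
    Matrix.dotProduct_mulVec, Matrix.vecMul_transpose, dotProduct]
  congr 1
  refine Finset.sum_congr rfl fun i _ => ?_
  have : (design D).mulVec v.ofLp i = inner ℝ (D i).1 v := by
    simp [Matrix.mulVec, dotProduct, design, PiLp.inner_apply, mul_comm]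
  rw [this, sq]

/-- Expand v in the orthonormal eigenbasis of the Gram matrix and bound each eigenvalue below by the
infimum. -/
theorem minEig_mul_le (D : ι → Obs p) (v : EuclideanSpace ℝ (Fin p)) :
    minEig D * ‖v‖ ^ 2 ≤ 1 / (Fintype.card ι : ℝ) * ∑ i, (inner ℝ (D i).1 v) ^ 2 := by
  set hG := gram_isHermitian D
  set e := hG.eigenvectorBasis
  have h1 : v.ofLp ⬝ᵥ (gram D).mulVec v.ofLp = ∑ i, hG.eigenvalues i * (inner ℝ v (e i)) ^ 2 := by
    have h2 : v.ofLp ⬝ᵥ (gram D).mulVec v.ofLp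
        = inner ℝ v (WithLp.toLp 2 ((gram D).mulVec v.ofLp)) := by
      simp [PiLp.inner_apply, dotProduct, mul_comm]
    rw [h2, ← e.sum_inner_mul_inner]
    refine Finset.sum_congr rfl fun i _ => ?_
    have h3 : inner ℝ (e i) (WithLp.toLp 2 ((gram D).mulVec v.ofLp))
        = hG.eigenvalues i * inner ℝ v (e i) := by
      have h4 : inner ℝ (e i) (WithLp.toLp 2 ((gram D).mulVec v.ofLp)) =
          (e i).ofLp ⬝ᵥ (gram D).mulVec v.ofLp := by
        simp [PiLp.inner_apply, dotProduct, mul_comm]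
      have h5 : (gram D).transpose = gram D := by
        simpa [Matrix.IsHermitian, Matrix.conjTranspose_eq_transpose_of_trivial] using hG
      rw [h4, Matrix.dotProduct_mulVec, ← Matrix.mulVec_transpose, h5, hG.mulVec_eigenvectorBasis,
        smul_dotProduct, smul_eq_mul]
      simp [PiLp.inner_apply, dotProduct, e]
    rw [h3]; ring
  rw [← inner_gram_eq, h1, ← e.sum_sq_inner_left, Finset.mul_sum]
  refine Finset.sum_le_sum fun i _ => mul_le_mul_of_nonneg_right ?_ (sq_nonneg _)
  exact ciInf_le (Set.finite_range _).bddBelow i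

end SampleAlgebra

/-! ### Curvature of the cross-validation criterion and the deterministic bound -/

section FoldAlgebra

variable {p K m : ℕ}

theorem rhoBar_le (d : Fin K × Fin m → Obs p) (q : Fin K) : rhoBar d ≤ minEig (testSet d q) :=
  ciInf_le (Set.finite_range _).bddBelow q

theorem sum_trainSet (d : Fin K × Fin m → Obs p) (k : Fin K) (f : Obs p → ℝ) :
    ∑ i, f (trainSet d k i) = ∑ q ∈ Finset.univ.erase k, ∑ i, f (d (q, i)) := by
  rw [Fintype.sum_prod_type]
  simp only [trainSet]
  rw [← Finset.sum_subtype (s := Finset.univ.erase k) (p := fun q => q ≠ k) (by simp)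
    (fun q => ∑ i, f (d (q, i)))]

theorem cvError_eq (d : Fin K × Fin m → Obs p) (b : EuclideanSpace ℝ (Fin p)) :
    cvError d b = 1 / ((K : ℝ) * m) * ∑ i, ((d i).2 - inner ℝ (d i).1 b) ^ 2 := by
  rw [cvError, Fintype.sum_prod_type, Finset.mul_sum, Finset.mul_sum]
  refine Finset.sum_congr rfl fun q _ => ?_
  rw [empRisk_eq, Fintype.card_fin, ← mul_assoc, one_div_mul_one_div]
  rfl

/-- Penalty 0 on training set `ks` makes `bt ks` a candidate. For consistency, this is all that is
used about the Lasso. -/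
theorem IsCVLasso.cvError_le {d : Fin K × Fin m → Obs p} {Pen : Set ℝ} {T : Set (Fin K)}
    {bt : Fin K → EuclideanSpace ℝ (Fin p)} {ks qs : Fin K} {b : EuclideanSpace ℝ (Fin p)}
    (hb : IsCVLasso d Pen T b) (hw : IsWorstCase d bt ks qs) (hks : ks ∈ T)
    (h0 : (0 : ℝ) ∈ Pen) : cvError d b ≤ cvError d (bt ks) :=
  hb.2 ks hks 0 h0 _ (isLasso_zero.mpr (hw.1 ks))

/-- Since K ≥ 2, a training set contains a whole fold, whose Gram matrix is already definite. -/
theorem trainSet_definite (hK : 2 ≤ K) {d : Fin K × Fin m → Obs p}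
    (hρ : 0 < rhoBar d) (k : Fin K) (v : EuclideanSpace ℝ (Fin p))
    (hv : ∑ i, (inner ℝ (trainSet d k i).1 v) ^ 2 = 0) : v = 0 := by
  have : Nontrivial (Fin K) := Fin.nontrivial_iff_two_le.mpr hK
  obtain ⟨q, hq⟩ := exists_ne k
  rw [sum_trainSet d k (fun z => (inner ℝ z.1 v) ^ 2)] at hv
  have h1 := (Finset.sum_eq_zero_iff_of_nonneg
    (fun q _ => Finset.sum_nonneg fun i _ => sq_nonneg _)).mp hv q (by simp [hq])
  have h2 := minEig_mul_le (testSet d q) v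
  simp only [testSet] at h2
  rw [h1, mul_zero] at h2
  have h3 : 0 < minEig (testSet d q) := hρ.trans_le (rhoBar_le d q)
  have h4 : ‖v‖ ^ 2 ≤ 0 := by
    by_contra! hc
    exact absurd h2 (not_le.mpr (mul_pos h3 hc))
  simpa using le_antisymm h4 (sq_nonneg _)

/-- The strong convexity of the cross-validation criterion. -/
theorem rhoBar_mul_norm_sq_le (hK : 2 ≤ K) (d : Fin K × Fin m → Obs p)
    (b v : EuclideanSpace ℝ (Fin p)) :
    rhoBar d * ‖v‖ ^ 2 ≤ cvError d (b + v) - cvError d b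
      + 1 / (K : ℝ) * ∑ q, 2 / (m : ℝ) * (scoreSup (testSet d q) b * l1Norm v) := by
  have hK0 : (0 : ℝ) < K := by exact_mod_cast (by omega : 0 < K)
  have h1 : ∀ q : Fin K, rhoBar d * ‖v‖ ^ 2 ≤ empRisk (testSet d q) (b + v)
      - empRisk (testSet d q) b + 2 / (m : ℝ) * (scoreSup (testSet d q) b * l1Norm v) := by
    intro q
    have h2 := minEig_mul_le (testSet d q) v
    have h3 := mul_le_mul_of_nonneg_right (rhoBar_le d q) (sq_nonneg ‖v‖)
    have h4 := (le_abs_self _).trans (abs_sum_residual_mul_le (testSet d q) b v)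
    have h5 : (0 : ℝ) ≤ 2 / (m : ℝ) := by positivity
    have h6 := mul_le_mul_of_nonneg_left h4 h5
    rw [empRisk_eq, empRisk_eq, sum_sq_residual_add]
    rw [Fintype.card_fin] at *
    have h7 : (2 : ℝ) / m = 2 * (1 / m) := by ring
    rw [h7] at h6 ⊢
    linarith
  calc rhoBar d * ‖v‖ ^ 2 = 1 / (K : ℝ) * ∑ _q : Fin K, rhoBar d * ‖v‖ ^ 2 := by
        rw [Finset.sum_const, Finset.card_univ, Fintype.card_fin, nsmul_eq_mul]; field_simp
    _ ≤ 1 / (K : ℝ) * ∑ q, (empRisk (testSet d q) (b + v)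
      - empRisk (testSet d q) b + 2 / (m : ℝ) * (scoreSup (testSet d q) b * l1Norm v)) :=
        mul_le_mul_of_nonneg_left (Finset.sum_le_sum fun q _ => h1 q) (by positivity)
    _ = _ := by
        rw [Finset.sum_add_distrib, Finset.sum_sub_distrib, cvError, cvError]; ring

theorem varsigma_nonneg {P : Measure (Obs p)} {r τ ϖ : ℝ} (hτ : 0 < τ) (hϖ : ϖ < 1)
    (n : ℕ) (b : EuclideanSpace ℝ (Fin p)) : 0 ≤ varsigma P r τ ϖ n b := by
  have h1 : 0 ≤ popRisk P b := integral_nonneg fun z => sq_nonneg _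
  have h2 : 0 ≤ 1 - ϖ := by linarith
  unfold varsigma
  positivity

theorem norm_sq_le_cvBound {P : Measure (Obs p)} {r τ ϖ : ℝ} {Pen : Set ℝ}
    (hK : 2 ≤ K) (hm : 1 ≤ m) (hτ : 0 < τ) (hϖ : ϖ < 1)
    (h0 : (0 : ℝ) ∈ Pen) (hPen : ∀ pen ∈ Pen, 0 ≤ pen) {d : Fin K × Fin m → Obs p}
    (hρ : 0 < rhoBar d) {bt : Fin K → EuclideanSpace ℝ (Fin p)} {ks qs : Fin K}
    {T : Set (Fin K)} {bL : EuclideanSpace ℝ (Fin p)} (hw : IsWorstCase d bt ks qs)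
    (hks : ks ∈ T) (hL : IsCVLasso d Pen T bL) (hT : T = {ks} ∨ l1Norm bL ≤ l1Norm (bt ks)) :
    ‖bt ks - bL‖ ^ 2 ≤ cvBound P r τ ϖ d qs (bt ks) := by
  have : Nontrivial (Fin K) := Fin.nontrivial_iff_two_le.mpr hK
  have : Nonempty ({k : Fin K // k ≠ ks} × Fin m) := by
    obtain ⟨q, hq⟩ := exists_ne ks
    exact ⟨⟨q, hq⟩, ⟨0, by omega⟩⟩
  -- On the path of `ks` a positive penalty can only shrink the ℓ¹ norm below that of OLS; at
  -- penalty 0 the Lasso is OLS, which is unique by definiteness.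
  have hl1 : l1Norm bL ≤ l1Norm (bt ks) := by
    rcases hT with rfl | h
    · obtain ⟨k, hk, pen, hpen, hl⟩ := hL.1
      obtain rfl : k = ks := hk
      rcases (hPen pen hpen).eq_or_lt with h | hpos
      · subst h
        rw [(hw.1 k).eq_of_definite (isLasso_zero.mp hl) (trainSet_definite hK hρ k)]
      · exact hl.l1Norm_le hpos (hw.1 k)
    · exact h
  have hcv := hL.cvError_le hw hks h0
  have h1 := rhoBar_mul_norm_sq_le hK d (bt ks) (bL - bt ks)
  rw [add_sub_cancel, norm_sub_rev] at h1
  have hl2 : l1Norm (bL - bt ks) ≤ 2 * l1Norm (bt ks) := by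
    linarith [l1Norm_sub_le bL (bt ks)]
  have h2 : 1 / (K : ℝ) * ∑ q, 2 / (m : ℝ) * (scoreSup (testSet d q) (bt ks)
        * l1Norm (bL - bt ks)) ≤
      rhoBar d * (1 / (K : ℝ) * ∑ q, 4 / (m * rhoBar d) * scoreSup (testSet d q) (bt ks)
        * l1Norm (bt ks)) := by
    rw [mul_left_comm, Finset.mul_sum (a := rhoBar d)]
    refine mul_le_mul_of_nonneg_left (Finset.sum_le_sum fun q _ => ?_) (by positivity)
    have h3 : rhoBar d * (4 / (m * rhoBar d) * scoreSup (testSet d q) (bt ks) * l1Norm (bt ks))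
        = 2 / (m : ℝ) * (scoreSup (testSet d q) (bt ks) * (2 * l1Norm (bt ks))) := by
      have : (m : ℝ) ≠ 0 := by exact_mod_cast (by omega : m ≠ 0)
      field_simp; ring
    rw [h3]
    have h4 : 0 ≤ scoreSup (testSet d q) (bt ks) := norm_nonneg _
    gcongr
  have h5 : ‖bt ks - bL‖ ^ 2 ≤ 1 / (K : ℝ) * ∑ q, 4 / (m * rhoBar d)
      * scoreSup (testSet d q) (bt ks) * l1Norm (bt ks) :=
    le_of_mul_le_mul_left (by linarith) hρ
  have h6 := div_nonneg (varsigma_nonneg (P := P) (r := r) hτ hϖ m (bt ks)) hρ.le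
  unfold cvBound
  refine h5.trans ?_
  have h7 := abs_nonneg (1 / (trainSize K m * rhoBar d) *
        (‖residual (trainSet d qs) (bt ks)‖ ^ 2 /
          (1 - √(vcEps p (trainSize K m) (1 / trainSize K m))))
      - 1 / (K : ℝ) * ∑ q, 1 / (m * rhoBar d) * ‖residual (testSet d q) (bt ks)‖ ^ 2)
  linarith

end FoldAlgebra

/-! ### Isotropic designs -/

/-- The law of `(x, u)` is isotropic: `u` is uncorrelated with `x`, `𝔼 x xᵀ = 1`, the losses
satisfy the moment comparison with constant `τ`, and `𝔼 u² ≤ s`. -/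
structure Isotropic {p : ℕ} (P : Measure (Obs p)) (r τ s : ℝ) : Prop where
  isProb : IsProbabilityMeasure P
  memLp_x : MemLp (fun z : Obs p => z.1) 2 P
  memLp_y : MemLp (fun z : Obs p => z.2) 2 P
  orth : ∀ v, ∫ z, z.2 * inner ℝ z.1 v ∂P = 0
  cov : ∀ v, ∫ z, (inner ℝ z.1 v) ^ 2 ∂P = ‖v‖ ^ 2
  one_lt : 1 < r
  one_le : 1 ≤ τ
  ratio : LossRatioBound P r τ
  risk : ∫ z, z.2 ^ 2 ∂P ≤ s

/-- Hölder's inequality on a set. -/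
theorem setLIntegral_ofReal_le {Ω : Type*} [MeasurableSpace Ω] {P : Measure Ω} {f : Ω → ℝ}
    (hf : AEStronglyMeasurable f P) {r M : ℝ} (hr : 1 < r)
    (hM : eLpNorm f (ENNReal.ofReal r) P ≤ ENNReal.ofReal M) (A : Set Ω) :
    ∫⁻ z in A, ENNReal.ofReal (f z) ∂P ≤ ENNReal.ofReal M * P A ^ (1 - 1 / r) := by
  have h1 : (1 : ENNReal) ≤ ENNReal.ofReal r := by
    rw [← ENNReal.ofReal_one]; exact ENNReal.ofReal_le_ofReal hr.le
  have h2 := eLpNorm_le_eLpNorm_mul_rpow_measure_univ h1 (hf.restrict (s := A))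
  rw [Measure.restrict_apply_univ, ENNReal.toReal_one, ENNReal.toReal_ofReal (by linarith),
    eLpNorm_one_eq_lintegral_enorm, div_one] at h2
  calc ∫⁻ z in A, ENNReal.ofReal (f z) ∂P ≤ ∫⁻ z in A, ‖f z‖ₑ ∂P :=
        lintegral_mono fun z => Real.ofReal_le_enorm _
    _ ≤ _ := h2
    _ ≤ _ := by
        gcongr
        exact (eLpNorm_mono_measure f Measure.restrict_le_self).trans hM

/-- The lower bound in the small-ball condition. -/
def smallBallConst (r τ : ℝ) : ℝ := (1 / (4 * τ)) ^ (r / (r - 1))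

theorem smallBallConst_pos {r τ : ℝ} (hτ : 0 < τ) : 0 < smallBallConst r τ := by
  unfold smallBallConst; positivity

namespace Isotropic

variable {p : ℕ} {P : Measure (Obs p)} {r τ s : ℝ}

theorem memLp_inner (h : Isotropic P r τ s) (v : EuclideanSpace ℝ (Fin p)) :
    MemLp (fun z : Obs p => (inner ℝ z.1 v : ℝ)) 2 P := h.memLp_x.inner_const v

theorem integrable_inner_sq (h : Isotropic P r τ s) (v : EuclideanSpace ℝ (Fin p)) :
    Integrable (fun z : Obs p => (inner ℝ z.1 v : ℝ) ^ 2) P := (h.memLp_inner v).integrable_sq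

theorem popRisk_eq (h : Isotropic P r τ s) (b : EuclideanSpace ℝ (Fin p)) :
    popRisk P b = (∫ z, z.2 ^ 2 ∂P) + ‖b‖ ^ 2 := by
  have h1 : Integrable (fun z : Obs p => z.2 * inner ℝ z.1 b) P :=
    h.memLp_y.integrable_mul (h.memLp_inner b)
  calc popRisk P b = ∫ z, (z.2 ^ 2 - 2 * (z.2 * inner ℝ z.1 b) + inner ℝ z.1 b ^ 2) ∂P := by
        refine integral_congr_ae (.of_forall fun z => ?_)
        simp only [loss]; ring
    _ = _ := by
        have h2 : Integrable (fun z : Obs p => z.2 ^ 2 - 2 * (z.2 * inner ℝ z.1 b)) P :=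
          h.memLp_y.integrable_sq.sub (h1.const_mul 2)
        rw [integral_add h2 (h.integrable_inner_sq b), integral_sub h.memLp_y.integrable_sq
          (h1.const_mul 2), integral_const_mul, h.orth, h.cov]
        ring

theorem risk_nonneg (h : Isotropic P r τ s) : 0 ≤ s :=
  (integral_nonneg fun _ => sq_nonneg _).trans h.risk

theorem measurable_loss (b : EuclideanSpace ℝ (Fin p)) : Measurable (loss b) := by
  unfold loss; fun_prop

theorem eLpNorm_noise_le (h : Isotropic P r τ s) :
    eLpNorm (fun z : Obs p => z.2 ^ 2) (ENNReal.ofReal r) P ≤ ENNReal.ofReal (τ * s) := by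
  have h1 := h.ratio 0
  have h0 : loss (0 : EuclideanSpace ℝ (Fin p)) = fun z => z.2 ^ 2 := by
    ext z; simp [loss]
  rw [h0, h.popRisk_eq, ← ENNReal.ofReal_mul (by linarith [h.one_le])] at h1
  refine h1.trans (ENNReal.ofReal_le_ofReal ?_)
  have := h.one_le
  have := h.risk
  simp only [norm_zero]
  gcongr
  linarith

/-- The moment comparison for the losses passes to the linear forms: bound ⟨x, tv⟩² by twice the
losses at 0 and at tv, divide by t² and let t tend to infinity. The noise disappears and the
constant becomes 2τ. -/
theorem eLpNorm_inner_sq_le (h : Isotropic P r τ s) (v : EuclideanSpace ℝ (Fin p)) :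
    eLpNorm (fun z : Obs p => (inner ℝ z.1 v : ℝ) ^ 2) (ENNReal.ofReal r) P
      ≤ ENNReal.ofReal (2 * τ * ‖v‖ ^ 2) := by
  set f := fun z : Obs p => (inner ℝ z.1 v : ℝ) ^ 2 with hf
  have hτ := h.one_le
  set R := ∫ z, z.2 ^ 2 ∂P
  have hR : 0 ≤ R := integral_nonneg fun _ => sq_nonneg _
  have h1r : (1 : ENNReal) ≤ ENNReal.ofReal r := by
    rw [← ENNReal.ofReal_one]; exact ENNReal.ofReal_le_ofReal h.one_lt.le
  have key : ∀ t : ℝ, 0 < t → eLpNorm f (ENNReal.ofReal r) P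
      ≤ ENNReal.ofReal (2 * τ * ‖v‖ ^ 2 + 4 * τ * R / t ^ 2) := by
    intro t ht
    have h1 : eLpNorm ((2 : ℝ) • loss (0 : EuclideanSpace ℝ (Fin p)) + (2 : ℝ) • loss (t • v))
        (ENNReal.ofReal r) P ≤ ENNReal.ofReal (2 * (τ * R) + 2 * (τ * (R + t ^ 2 * ‖v‖ ^ 2))) := by
      refine (eLpNorm_add_le ((measurable_loss _).aestronglyMeasurable.const_smul _)
        ((measurable_loss _).aestronglyMeasurable.const_smul _) h1r).trans ?_
      rw [ENNReal.ofReal_add (by positivity) (by positivity), eLpNorm_const_smul,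
        eLpNorm_const_smul]
      have e2 : ‖(2 : ℝ)‖ₑ = ENNReal.ofReal 2 := by simp [Real.enorm_eq_ofReal_abs]
      rw [e2, ENNReal.ofReal_mul (by norm_num) (q := τ * R),
        ENNReal.ofReal_mul (by norm_num) (q := τ * (R + t ^ 2 * ‖v‖ ^ 2)),
        ENNReal.ofReal_mul (by linarith), ENNReal.ofReal_mul (by linarith)]
      have a1 := h.ratio 0
      have a2 := h.ratio (t • v)
      rw [h.popRisk_eq] at a1 a2
      rw [norm_smul, mul_pow, Real.norm_eq_abs, sq_abs] at a2
      simp only [norm_zero, ne_eq, OfNat.ofNat_ne_zero, not_false_eq_true, zero_pow, add_zero] at a1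
      gcongr
    have h2 : eLpNorm ((t ^ 2) • f) (ENNReal.ofReal r) P
        ≤ ENNReal.ofReal (2 * (τ * R) + 2 * (τ * (R + t ^ 2 * ‖v‖ ^ 2))) := by
      refine (eLpNorm_mono_real fun z => ?_).trans h1
      simp only [Pi.smul_apply, Pi.add_apply, smul_eq_mul, hf, loss, inner_zero_right,
        inner_smul_right]
      rw [Real.norm_of_nonneg (by positivity)]
      nlinarith [sq_nonneg (z.2 + (z.2 - t * inner ℝ z.1 v))]
    rw [eLpNorm_const_smul, Real.enorm_eq_ofReal_abs, abs_of_pos (by positivity)] at h2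
    have h3 : ENNReal.ofReal (t ^ 2) * eLpNorm f (ENNReal.ofReal r) P ≤
        ENNReal.ofReal (t ^ 2) * ENNReal.ofReal (2 * τ * ‖v‖ ^ 2 + 4 * τ * R / t ^ 2) := by
      rw [← ENNReal.ofReal_mul (by positivity)]
      refine h2.trans (ENNReal.ofReal_le_ofReal (le_of_eq ?_))
      field_simp; ring
    exact (ENNReal.mul_le_mul_iff_right (by simpa using ht.ne') ENNReal.ofReal_ne_top).mp h3
  refine ge_of_tendsto (x := atTop)
    (f := fun t : ℝ => ENNReal.ofReal (2 * τ * ‖v‖ ^ 2 + 4 * τ * R / t ^ 2)) ?_ ?_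
  · refine ENNReal.tendsto_ofReal ?_
    have : Tendsto (fun t : ℝ => 4 * τ * R / t ^ 2) atTop (𝓝 0) :=
      tendsto_const_nhds.div_atTop (tendsto_pow_atTop two_ne_zero)
    simpa using this.const_add (2 * τ * ‖v‖ ^ 2)
  · filter_upwards [eventually_gt_atTop 0] with t ht using key t ht

theorem lintegral_inner_sq (h : Isotropic P r τ s) (v : EuclideanSpace ℝ (Fin p)) :
    ∫⁻ z, ENNReal.ofReal ((inner ℝ z.1 v : ℝ) ^ 2) ∂P = ENNReal.ofReal (‖v‖ ^ 2) := by
  rw [← h.cov v, ofReal_integral_eq_lintegral_ofReal (h.integrable_inner_sq v)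
    (.of_forall fun _ => sq_nonneg _)]

/-- A Paley–Zygmund argument: the complement of the event contributes at most half of E⟨x, v⟩² =
‖v‖², so by Hölder the event must carry the rest, 1/2 ≤ 2τ P(A)^(1 - 1/r). -/
theorem smallBall (h : Isotropic P r τ s) {v : EuclideanSpace ℝ (Fin p)} (hv : v ≠ 0) :
    ENNReal.ofReal (smallBallConst r τ) ≤ P {z | ‖v‖ ^ 2 / 2 ≤ (inner ℝ z.1 v : ℝ) ^ 2} := by
  have := h.isProb
  have hτ := h.one_le
  have hr := h.one_lt
  set A := {z : Obs p | ‖v‖ ^ 2 / 2 ≤ (inner ℝ z.1 v : ℝ) ^ 2} with hA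
  have hAm : MeasurableSet A := measurableSet_le (by fun_prop) (by fun_prop)
  have hvp : 0 < ‖v‖ ^ 2 := by positivity
  have h1 := setLIntegral_ofReal_le (h.integrable_inner_sq v).aestronglyMeasurable hr
    (h.eLpNorm_inner_sq_le v) A
  have h2 : ∫⁻ z in Aᶜ, ENNReal.ofReal ((inner ℝ z.1 v : ℝ) ^ 2) ∂P
      ≤ ENNReal.ofReal (‖v‖ ^ 2 / 2) := by
    calc _ ≤ ∫⁻ z in Aᶜ, ENNReal.ofReal (‖v‖ ^ 2 / 2) ∂P := by
          refine setLIntegral_mono measurable_const fun z hz => ENNReal.ofReal_le_ofReal ?_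
          simp only [hA, Set.mem_compl_iff, Set.mem_ofPred_eq, not_le] at hz
          exact hz.le
      _ ≤ _ := by
          rw [setLIntegral_const]
          exact mul_le_of_le_one_right zero_le prob_le_one
  have h3 := lintegral_add_compl
    (μ := P) (fun z : Obs p => ENNReal.ofReal ((inner ℝ z.1 v : ℝ) ^ 2)) hAm
  rw [h.lintegral_inner_sq] at h3
  have h4 : ENNReal.ofReal (‖v‖ ^ 2) ≤
      ENNReal.ofReal (2 * τ * ‖v‖ ^ 2) * P A ^ (1 - 1 / r) + ENNReal.ofReal (‖v‖ ^ 2 / 2) := by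
    rw [← h3]; exact add_le_add h1 h2
  have hθ : 0 < 1 - 1 / r := by
    rw [sub_pos, div_lt_one (by linarith)]; exact hr
  have h5 : P A = ENNReal.ofReal (P.real A) := by simp
  rw [h5, ENNReal.ofReal_rpow_of_nonneg measureReal_nonneg hθ.le,
    ← ENNReal.ofReal_mul (by positivity), ← ENNReal.ofReal_add (by positivity) (by positivity),
    ENNReal.ofReal_le_ofReal_iff (by positivity)] at h4
  have h6 : 1 / (4 * τ) ≤ P.real A ^ (1 - 1 / r) := by
    rw [div_le_iff₀ (by positivity)]
    have : ‖v‖ ^ 2 * 1 ≤ ‖v‖ ^ 2 * (P.real A ^ (1 - 1 / r) * (4 * τ)) := by nlinarith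
    exact le_of_mul_le_mul_left this hvp
  rw [h5]
  refine ENNReal.ofReal_le_ofReal ?_
  have h7 := Real.rpow_le_rpow (by positivity) h6 (z := r / (r - 1))
    (div_nonneg (by linarith) (by linarith))
  rw [← Real.rpow_mul measureReal_nonneg] at h7
  have h8 : (1 - 1 / r) * (r / (r - 1)) = 1 := by
    have : r - 1 ≠ 0 := by linarith
    have : r ≠ 0 := by linarith
    field_simp
  rwa [h8, Real.rpow_one] at h7

theorem lintegral_norm_sq (h : Isotropic P r τ s) :
    ∫⁻ z, ENNReal.ofReal (‖z.1‖ ^ 2) ∂P = ENNReal.ofReal p := by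
  have h1 : ∀ z : Obs p, ENNReal.ofReal (‖z.1‖ ^ 2)
      = ∑ j : Fin p, ENNReal.ofReal ((inner ℝ z.1 (EuclideanSpace.single j (1 : ℝ)) : ℝ) ^ 2) := by
    intro z
    rw [← ENNReal.ofReal_sum_of_nonneg fun _ _ => sq_nonneg _, EuclideanSpace.real_norm_sq_eq]
    simp [EuclideanSpace.inner_single_right]
  simp_rw [h1]
  rw [lintegral_finsetSum _ fun j _ => by fun_prop]
  simp [h.lintegral_inner_sq]

end Isotropic

/-! ### A uniform lower bound for empirical Gram matrices -/

/-- The reflection exchanging x and y preserves both the ball and Lebesgue measure. -/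
theorem setLIntegral_ball_inner_sq_congr {p : ℕ} {x y : EuclideanSpace ℝ (Fin p)}
    (hxy : ‖x‖ = ‖y‖) (ρ : ℝ) :
    ∫⁻ ω in Metric.ball (0 : EuclideanSpace ℝ (Fin p)) ρ, ENNReal.ofReal ((inner ℝ x ω : ℝ) ^ 2) =
      ∫⁻ ω in Metric.ball (0 : EuclideanSpace ℝ (Fin p)) ρ,
        ENNReal.ofReal ((inner ℝ y ω : ℝ) ^ 2) := by
  set L := (ℝ ∙ (x - y))ᗮ.reflection
  have hL : L x = y := Submodule.reflection_sub hxy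
  have hmp : MeasurePreserving L volume volume := L.measurePreserving
  have hpre : L ⁻¹' (Metric.ball 0 ρ) = Metric.ball 0 ρ := by
    ext ω; simp
  rw [← hmp.setLIntegral_comp_preimage (f := fun ω => ENNReal.ofReal ((inner ℝ y ω : ℝ) ^ 2))
    Metric.isOpen_ball.measurableSet (by fun_prop), hpre]
  refine lintegral_congr fun ω => ?_
  rw [← hL, LinearIsometryEquiv.inner_map_map]

/-- By rotation invariance x may be replaced by ‖x‖ times any basis vector; summing over all p of
them produces ‖x‖² ‖ω‖². The gain of the factor 1/p over the trivial bound is what the volume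
argument needs. -/
theorem setLIntegral_ball_inner_sq_le {p : ℕ} (hp : 1 ≤ p) (x : EuclideanSpace ℝ (Fin p))
    (ρ : ℝ) :
    ∫⁻ ω in Metric.ball (0 : EuclideanSpace ℝ (Fin p)) ρ, ENNReal.ofReal ((inner ℝ x ω : ℝ) ^ 2) ≤
      ENNReal.ofReal (ρ ^ 2 * ‖x‖ ^ 2 / p)
        * volume (Metric.ball (0 : EuclideanSpace ℝ (Fin p)) ρ) := by
  have hp0 : (0 : ℝ) < p := by exact_mod_cast hp
  set I := ∫⁻ ω in Metric.ball (0 : EuclideanSpace ℝ (Fin p)) ρ,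
    ENNReal.ofReal ((inner ℝ x ω : ℝ) ^ 2) with hI
  have h1 : ∀ j : Fin p, I = ∫⁻ ω in Metric.ball (0 : EuclideanSpace ℝ (Fin p)) ρ,
      ENNReal.ofReal (‖x‖ ^ 2 * (ω j) ^ 2) := by
    intro j
    rw [hI, setLIntegral_ball_inner_sq_congr
      (y := EuclideanSpace.single j ‖x‖) (by simp) ρ]
    refine lintegral_congr fun ω => ?_
    rw [EuclideanSpace.inner_single_left]
    simp [mul_pow]
  have h2 : (p : ENNReal) * I ≤ ENNReal.ofReal (ρ ^ 2 * ‖x‖ ^ 2)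
        * volume (Metric.ball (0 : EuclideanSpace ℝ (Fin p)) ρ) := by
    calc (p : ENNReal) * I = ∑ _j : Fin p, I := by simp
      _ = ∑ j : Fin p, ∫⁻ ω in Metric.ball (0 : EuclideanSpace ℝ (Fin p)) ρ,
          ENNReal.ofReal (‖x‖ ^ 2 * (ω j) ^ 2) := Finset.sum_congr rfl fun j _ => h1 j
      _ = ∫⁻ ω in Metric.ball (0 : EuclideanSpace ℝ (Fin p)) ρ,
          ENNReal.ofReal (‖x‖ ^ 2 * ‖ω‖ ^ 2) := by
          rw [← lintegral_finsetSum _ fun j _ => by fun_prop]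
          refine lintegral_congr fun ω => ?_
          rw [← ENNReal.ofReal_sum_of_nonneg fun _ _ => by positivity, ← Finset.mul_sum,
            ← EuclideanSpace.real_norm_sq_eq ω]
      _ ≤ ∫⁻ _ω in Metric.ball (0 : EuclideanSpace ℝ (Fin p)) ρ,
          ENNReal.ofReal (ρ ^ 2 * ‖x‖ ^ 2) := by
          refine setLIntegral_mono measurable_const fun ω hω => ENNReal.ofReal_le_ofReal ?_
          have : ‖ω‖ ≤ ρ := (mem_ball_zero_iff.mp hω).le
          rw [mul_comm]
          gcongr
      _ = _ := by rw [setLIntegral_const]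
  rw [ENNReal.ofReal_div_of_pos hp0, ENNReal.ofReal_natCast, ENNReal.mul_div_right_comm.symm]
  rw [ENNReal.le_div_iff_mul_le (by left; positivity) (by left; simp), mul_comm]
  exact h2

namespace Isotropic

variable {p : ℕ} {P : Measure (Obs p)} {r τ s : ℝ}

theorem lintegral_exp_le (h : Isotropic P r τ s) {v : EuclideanSpace ℝ (Fin p)}
    (hv : 1 / 2 ≤ ‖v‖) :
    ∫⁻ z, ENNReal.ofReal (Real.exp (-8 * (inner ℝ z.1 v : ℝ) ^ 2)) ∂P
      ≤ ENNReal.ofReal (Real.exp (-(smallBallConst r τ / 2))) := by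
  have := h.isProb
  set A := {z : Obs p | ‖v‖ ^ 2 / 2 ≤ (inner ℝ z.1 v : ℝ) ^ 2} with hA
  have hAm : MeasurableSet A := measurableSet_le (by fun_prop) (by fun_prop)
  have hv0 : v ≠ 0 := by rintro rfl; norm_num at hv
  have hsb := h.smallBall hv0
  rw [← hA, ENNReal.ofReal_le_iff_le_toReal (by simp), ← measureReal_def] at hsb
  rw [← lintegral_add_compl _ hAm]
  have h1 : ∫⁻ z in A, ENNReal.ofReal (Real.exp (-8 * (inner ℝ z.1 v : ℝ) ^ 2)) ∂P
      ≤ ENNReal.ofReal (1 / 2) * P A := by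
    rw [← setLIntegral_const]
    refine setLIntegral_mono measurable_const fun z hz => ENNReal.ofReal_le_ofReal ?_
    have hz' : ‖v‖ ^ 2 / 2 ≤ (inner ℝ z.1 v : ℝ) ^ 2 := hz
    -- With ‖v‖ ≥ 1/2 the squared form is at least 1/8 on A; this explains the factor 8. Then
    -- exp(-1) ≤ 1/2 gives a total of at most 1 - P(A)/2.
    have h2 : -8 * (inner ℝ z.1 v : ℝ) ^ 2 ≤ -1 := by nlinarith
    refine (Real.exp_le_exp.mpr h2).trans ?_
    have := Real.exp_neg_one_lt_d9
    linarith
  have h2 : ∫⁻ z in Aᶜ, ENNReal.ofReal (Real.exp (-8 * (inner ℝ z.1 v : ℝ) ^ 2)) ∂P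
      ≤ ENNReal.ofReal 1 * P Aᶜ := by
    rw [← setLIntegral_const]
    refine setLIntegral_mono measurable_const fun z _ => ENNReal.ofReal_le_ofReal ?_
    rw [Real.exp_le_one_iff]
    nlinarith [sq_nonneg (inner ℝ z.1 v : ℝ)]
  refine (add_le_add h1 h2).trans ?_
  have e1 : P A = ENNReal.ofReal (P.real A) := by simp
  have e2 : P Aᶜ = ENNReal.ofReal (1 - P.real A) := by
    rw [← probReal_compl_eq_one_sub hAm]; simp
  have h3 : P.real A ≤ 1 := measureReal_le_one
  rw [e1, e2, ← ENNReal.ofReal_mul (by norm_num), ← ENNReal.ofReal_mul (by norm_num),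
    ← ENNReal.ofReal_add (by positivity) (by linarith)]
  refine ENNReal.ofReal_le_ofReal ?_
  have := Real.add_one_le_exp (-(smallBallConst r τ / 2))
  linarith

/-- The lower tail of the quadratic form in a fixed direction. -/
theorem pi_sum_inner_sq_le (h : Isotropic P r τ s) {v : EuclideanSpace ℝ (Fin p)}
    (hv : 1 / 2 ≤ ‖v‖) (m : ℕ) :
    Measure.pi (fun _ : Fin m => P)
        {D | ∑ i, (inner ℝ (D i).1 v : ℝ) ^ 2 ≤ smallBallConst r τ / 32 * m}
      ≤ ENNReal.ofReal (Real.exp (-(smallBallConst r τ / 4 * m))) := by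
  have := h.isProb
  set Q := smallBallConst r τ
  set f : Obs p → ENNReal := fun z => ENNReal.ofReal (Real.exp (-8 * (inner ℝ z.1 v : ℝ) ^ 2))
    with hf
  have hfm : Measurable f := by fun_prop
  have h1 : ∫⁻ D, ∏ i, f (D i) ∂(Measure.pi fun _ : Fin m => P)
      ≤ ENNReal.ofReal (Real.exp (-(Q / 2))) ^ m := by
    have hind : ProbabilityTheory.iIndepFun (fun (i : Fin m) (D : Fin m → Obs p) => f (D i))
        (Measure.pi fun _ : Fin m => P) :=
      ProbabilityTheory.iIndepFun_pi (X := fun _ => f) fun _ => hfm.aemeasurable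
    rw [ProbabilityTheory.lintegral_prod_eq_prod_lintegral_of_indepFun Finset.univ _ hind
      fun i => by fun_prop]
    refine (Finset.prod_le_prod' (g := fun _ => ENNReal.ofReal (Real.exp (-(Q / 2))))
      fun i _ => ?_).trans (by simp)
    have := (measurePreserving_eval (fun _ : Fin m => P) i).lintegral_comp hfm
    exact this.le.trans (h.lintegral_exp_le hv)
  set S := {D : Fin m → Obs p | ∑ i, (inner ℝ (D i).1 v : ℝ) ^ 2 ≤ Q / 32 * m} with hS
  -- Chernoff: on S the product is at least exp(-8 · Q m / 32) = exp(-Q m / 4), against a mean of at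
  -- most exp(-Q m / 2).
  have h2 : ENNReal.ofReal (Real.exp (-(Q / 4 * m))) * Measure.pi (fun _ : Fin m => P) S
      ≤ ENNReal.ofReal (Real.exp (-(Q / 2))) ^ m := by
    refine le_trans ?_ h1
    refine le_trans ?_ (mul_meas_ge_le_lintegral (by fun_prop)
      (ENNReal.ofReal (Real.exp (-(Q / 4 * m)))))
    gcongr
    intro D hD
    have hD' : ∑ i, (inner ℝ (D i).1 v : ℝ) ^ 2 ≤ Q / 32 * m := hD
    simp only [Set.mem_ofPred_eq, hf]
    rw [← ENNReal.ofReal_prod_of_nonneg fun _ _ => (Real.exp_pos _).le, ← Real.exp_sum,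
      ← Finset.mul_sum]
    refine ENNReal.ofReal_le_ofReal (Real.exp_le_exp.mpr ?_)
    linarith
  have h3 : ENNReal.ofReal (Real.exp (-(Q / 2))) ^ m = ENNReal.ofReal (Real.exp (-(Q / 4 * m)))
      * ENNReal.ofReal (Real.exp (-(Q / 4 * m))) := by
    rw [← ENNReal.ofReal_pow (Real.exp_pos _).le, ← ENNReal.ofReal_mul (Real.exp_pos _).le,
      ← Real.exp_nat_mul, ← Real.exp_add]
    congr 2; ring
  rw [h3] at h2
  exact (ENNReal.mul_le_mul_iff_right (by simpa using Real.exp_pos _) ENNReal.ofReal_ne_top).mp h2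

end Isotropic

/-- If `∑ ‖xᵢ‖²` is not too large, then a direction in which the quadratic form is small yields
a set of large volume on which it is small. -/
theorem volume_ball_le_of_sum_inner_sq_lt {p : ℕ} (hp : 1 ≤ p) {ι : Type*} [Fintype ι]
    (x : ι → EuclideanSpace ℝ (Fin p)) {ρ t : ℝ} (hρ : 0 < ρ) (hρ2 : ρ ≤ 1 / 2) (ht : 0 < t)
    (hx : ρ ^ 2 * ∑ i, ‖x i‖ ^ 2 ≤ t / 8 * p) {v : EuclideanSpace ℝ (Fin p)}
    (hv : ∑ i, (inner ℝ (x i) v : ℝ) ^ 2 < t / 4 * ‖v‖ ^ 2) :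
    volume (Metric.ball (0 : EuclideanSpace ℝ (Fin p)) ρ) ≤ 2 * volume
      {θ : EuclideanSpace ℝ (Fin p) | θ ∈ Metric.ball 0 2 ∧ 1 / 2 ≤ ‖θ‖ ∧
        ∑ i, (inner ℝ (x i) θ : ℝ) ^ 2 ≤ t} := by
  have hp0 : (0 : ℝ) < p := by exact_mod_cast hp
  have hv0 : v ≠ 0 := by
    rintro rfl
    simp at hv
  have hvp : 0 < ‖v‖ := norm_pos_iff.mpr hv0
  set w := ‖v‖⁻¹ • v with hw
  have hwn : ‖w‖ = 1 := by rw [hw, norm_smul, norm_inv, norm_norm, inv_mul_cancel₀ hvp.ne']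
  have hwq : ∑ i, (inner ℝ (x i) w : ℝ) ^ 2 ≤ t / 4 := by
    have : ∑ i, (inner ℝ (x i) w : ℝ) ^ 2 = (‖v‖ ^ 2)⁻¹ * ∑ i, (inner ℝ (x i) v : ℝ) ^ 2 := by
      rw [Finset.mul_sum]
      refine Finset.sum_congr rfl fun i _ => ?_
      rw [hw, inner_smul_right, mul_pow, inv_pow]
    rw [this, inv_mul_le_iff₀ (by positivity), mul_comm]
    exact hv.le
  set q : EuclideanSpace ℝ (Fin p) → ℝ := fun θ => ∑ i, (inner ℝ (x i) θ : ℝ) ^ 2 with hq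
  have hqm : Measurable q := by fun_prop
  set B := Metric.ball (0 : EuclideanSpace ℝ (Fin p)) ρ with hB
  have hBfin : volume B ≠ ⊤ := measure_ball_lt_top.ne
  set G := {ω | q ω ≤ t / 4} with hG
  have hGm : MeasurableSet G := measurableSet_le hqm measurable_const
  -- The mean of q over the small ball is at most t/8, so by Markov q ≤ t/4 on at least half of it.
  have hint : ∫⁻ ω in B, ENNReal.ofReal (q ω) ≤ ENNReal.ofReal (t / 8) * volume B := by
    calc ∫⁻ ω in B, ENNReal.ofReal (q ω)
        = ∑ i, ∫⁻ ω in B, ENNReal.ofReal ((inner ℝ (x i) ω : ℝ) ^ 2) := by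
          rw [← lintegral_finsetSum _ fun j _ => by fun_prop]
          refine lintegral_congr fun ω => ?_
          rw [← ENNReal.ofReal_sum_of_nonneg fun _ _ => by positivity]
      _ ≤ ∑ i, ENNReal.ofReal (ρ ^ 2 * ‖x i‖ ^ 2 / p) * volume B :=
          Finset.sum_le_sum fun i _ => setLIntegral_ball_inner_sq_le hp (x i) ρ
      _ = ENNReal.ofReal (∑ i, ρ ^ 2 * ‖x i‖ ^ 2 / p) * volume B := by
          rw [← Finset.sum_mul, ← ENNReal.ofReal_sum_of_nonneg fun _ _ => by positivity]
      _ ≤ _ := by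
          gcongr
          rw [← Finset.sum_div, ← Finset.mul_sum, div_le_iff₀ hp0]
          exact hx
  have hGc : ENNReal.ofReal (t / 4) * volume (B \ G) ≤ ENNReal.ofReal (t / 8) * volume B := by
    refine le_trans ?_ hint
    refine le_trans ?_ (mul_meas_ge_le_lintegral (by fun_prop) (ENNReal.ofReal (t / 4)))
    rw [Measure.restrict_apply (measurableSet_le measurable_const (by fun_prop))]
    gcongr
    rintro ω ⟨hωB, hωG⟩
    refine ⟨ENNReal.ofReal_le_ofReal ?_, hωB⟩
    simp only [hG, Set.mem_ofPred_eq, not_le] at hωG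
    exact hωG.le
  have hGc2 : 2 * volume (B \ G) ≤ volume B := by
    have e : ENNReal.ofReal (t / 4) = ENNReal.ofReal (t / 8) * 2 := by
      rw [← ENNReal.ofReal_ofNat 2, ← ENNReal.ofReal_mul (by positivity)]
      congr 1; norm_num; ring
    rw [e, mul_assoc] at hGc
    exact (ENNReal.mul_le_mul_iff_right (by simpa using ht) ENNReal.ofReal_ne_top).mp hGc
  have hsplit : volume B = volume (B ∩ G) + volume (B \ G) := (measure_inter_add_sdiff B hGm).symm
  have hhalf : volume B ≤ 2 * volume (B ∩ G) := by
    have h1 : volume B + volume B ≤ 2 * volume (B ∩ G) + volume B := by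
      calc volume B + volume B = 2 * volume (B ∩ G) + 2 * volume (B \ G) := by
            rw [← two_mul, hsplit, mul_add]
        _ ≤ _ := by gcongr
    exact (ENNReal.add_le_add_iff_right hBfin).mp h1
  refine hhalf.trans ?_
  gcongr 2 * ?_
  -- Translate the good half of the small ball to the bad unit vector w. There q(w + ω) ≤ 2 q(w) + 2
  -- q(ω) ≤ t, and ρ ≤ 1/2 keeps the norm between 1/2 and 2.
  rw [← measure_preimage_add volume (-w) (B ∩ G)]
  refine measure_mono fun θ hθ => ?_
  obtain ⟨h1, h2⟩ := hθ
  set ω := -w + θ with hω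
  have hθω : θ = w + ω := by rw [hω]; abel
  have h1' : ‖ω‖ < ρ := mem_ball_zero_iff.mp h1
  have h2' : q ω ≤ t / 4 := h2
  have h3 : ‖θ‖ ≤ ‖w‖ + ‖ω‖ := by rw [hθω]; exact norm_add_le _ _
  have h4 : ‖w‖ ≤ ‖θ‖ + ‖ω‖ := by
    have : w = θ - ω := by rw [hθω]; abel
    calc ‖w‖ = ‖θ - ω‖ := by rw [← this]
      _ ≤ _ := norm_sub_le _ _
  refine ⟨mem_ball_zero_iff.mpr (by linarith), by linarith, ?_⟩
  calc ∑ i, (inner ℝ (x i) θ : ℝ) ^ 2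
      ≤ ∑ i, (2 * (inner ℝ (x i) w : ℝ) ^ 2 + 2 * (inner ℝ (x i) ω : ℝ) ^ 2) := by
        refine Finset.sum_le_sum fun i _ => ?_
        rw [hθω, inner_add_right]
        nlinarith [sq_nonneg ((inner ℝ (x i) w : ℝ) - inner ℝ (x i) ω)]
    _ = 2 * ∑ i, (inner ℝ (x i) w : ℝ) ^ 2 + 2 * q ω := by
        rw [Finset.sum_add_distrib, ← Finset.mul_sum, ← Finset.mul_sum]
    _ ≤ t := by linarith

theorem measurableSet_quadForm_le (p m : ℕ) (t : ℝ) :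
    MeasurableSet {x : (Fin m → Obs p) × EuclideanSpace ℝ (Fin p) |
      x.2 ∈ Metric.ball 0 2 ∧ 1 / 2 ≤ ‖x.2‖ ∧ ∑ i, (inner ℝ (x.1 i).1 x.2 : ℝ) ^ 2 ≤ t} := by
  have h1 : MeasurableSet {x : (Fin m → Obs p) × EuclideanSpace ℝ (Fin p) | 1 / 2 ≤ ‖x.2‖} :=
    measurableSet_le measurable_const (by fun_prop)
  have h2 : MeasurableSet {x : (Fin m → Obs p) × EuclideanSpace ℝ (Fin p) |
      ∑ i, (inner ℝ (x.1 i).1 x.2 : ℝ) ^ 2 ≤ t} :=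
    measurableSet_le (by fun_prop) measurable_const
  exact (Metric.isOpen_ball.measurableSet.preimage measurable_snd).inter (h1.inter h2)

namespace Isotropic

variable {p : ℕ} {P : Measure (Obs p)} {r τ s : ℝ}

/-- Tonelli: the expected volume of bad directions is the integral over directions of the
probability of being bad, to which the fixed-direction tail applies. -/
theorem lintegral_volume_le (h : Isotropic P r τ s) (m : ℕ) :
    ∫⁻ D, volume {θ : EuclideanSpace ℝ (Fin p) | θ ∈ Metric.ball 0 2 ∧ 1 / 2 ≤ ‖θ‖ ∧
        ∑ i, (inner ℝ (D i).1 θ : ℝ) ^ 2 ≤ smallBallConst r τ / 32 * m}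
        ∂(Measure.pi fun _ : Fin m => P)
      ≤ ENNReal.ofReal (Real.exp (-(smallBallConst r τ / 4 * m)))
        * volume (Metric.ball (0 : EuclideanSpace ℝ (Fin p)) 2) := by
  have := h.isProb
  set t := smallBallConst r τ / 32 * m
  set S : Set ((Fin m → Obs p) × EuclideanSpace ℝ (Fin p)) :=
    {x | x.2 ∈ Metric.ball 0 2 ∧ 1 / 2 ≤ ‖x.2‖ ∧ ∑ i, (inner ℝ (x.1 i).1 x.2 : ℝ) ^ 2 ≤ t} with hS
  have hSm : MeasurableSet S := measurableSet_quadForm_le p m t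
  have h1 := Measure.prod_apply (μ := Measure.pi fun _ : Fin m => P)
    (ν := (volume : Measure (EuclideanSpace ℝ (Fin p)))) hSm
  have h2 := Measure.prod_apply_symm (μ := Measure.pi fun _ : Fin m => P)
    (ν := (volume : Measure (EuclideanSpace ℝ (Fin p)))) hSm
  refine le_trans (le_of_eq (h1.symm.trans h2)) ?_
  rw [← setLIntegral_const, ← lintegral_indicator Metric.isOpen_ball.measurableSet]
  refine lintegral_mono fun θ => ?_
  by_cases hθ : θ ∈ Metric.ball (0 : EuclideanSpace ℝ (Fin p)) 2 ∧ 1 / 2 ≤ ‖θ‖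
  · rw [Set.indicator_of_mem hθ.1]
    refine le_trans (measure_mono fun D hD => ?_) (h.pi_sum_inner_sq_le hθ.2 m)
    exact hD.2.2
  · have : (fun D => (D, θ)) ⁻¹' S = ∅ := by
      ext D
      simp only [hS, Set.mem_preimage, Set.mem_ofPred_eq, Set.mem_empty_iff_false, iff_false]
      exact fun hc => hθ ⟨hc.1, hc.2.1⟩
    rw [this, measure_empty]
    exact zero_le

end Isotropic

/-- Lower bound on empirical Gram matrices, uniform over directions, as soon as the ratio of
dimension to sample size is small. -/
theorem exists_gram_lower (r : ℝ) {τ : ℝ} (hτ : 1 ≤ τ) {η : ℝ} (hη : 0 < η) :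
    ∃ κ > 0, ∀ (p m : ℕ) (P : Measure (Obs p)) (s : ℝ), 1 ≤ p → (p : ℝ) ≤ κ * m →
      Isotropic P r τ s → ∃ N : Set (Fin m → Obs p), MeasurableSet N ∧
        Measure.pi (fun _ : Fin m => P) N ≤ ENNReal.ofReal η ∧
        ∀ D ∉ N, ∀ v, smallBallConst r τ / 128 * m * ‖v‖ ^ 2
          ≤ ∑ i, (inner ℝ (D i).1 v : ℝ) ^ 2 := by
  set Q := smallBallConst r τ
  have hQ : 0 < Q := smallBallConst_pos (by linarith)
  -- The factor 2/η is the Markov level for ∑ ‖xᵢ‖², whose mean is p m; the right-hand side is t/8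
  -- per observation for t = Q m / 32.
  obtain ⟨ρ, hρ, hρ2, hρη⟩ : ∃ ρ : ℝ, 0 < ρ ∧ ρ ≤ 1 / 2 ∧ ρ ^ 2 * (2 / η) ≤ Q / 32 / 8 := by
    refine ⟨min (1 / 2) (√(Q * η / 512)), by positivity, min_le_left _ _, ?_⟩
    have h1 : (min (1 / 2) (√(Q * η / 512))) ^ 2 ≤ Q * η / 512 := by
      calc _ ≤ (√(Q * η / 512)) ^ 2 := by gcongr; exact min_le_right _ _
        _ = _ := Real.sq_sqrt (by positivity)
    calc _ ≤ Q * η / 512 * (2 / η) := by gcongr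
      _ = _ := by field_simp; norm_num
  set C := Real.log (2 / ρ) + Real.log 2 + |Real.log (2 / η)| + 1 with hC
  have hL : 0 < Real.log (2 / ρ) := Real.log_pos (by rw [lt_div_iff₀ hρ]; linarith)
  have hl2 : 0 < Real.log 2 := Real.log_pos (by norm_num)
  have hCpos : 0 < C := by positivity
  refine ⟨Q / (8 * C), by positivity, fun p m P s hp hpm h => ?_⟩
  have := h.isProb
  have hp1 : (1 : ℝ) ≤ p := by exact_mod_cast hp
  have hpC : p * C ≤ Q * m / 8 := by
    have := mul_le_mul_of_nonneg_right hpm hCpos.le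
    calc p * C ≤ Q / (8 * C) * m * C := this
      _ = _ := by field_simp
  have hm0 : (0 : ℝ) < m := by
    by_contra! hc
    have : p * C ≤ 0 := hpC.trans (by nlinarith)
    nlinarith
  set F : (Fin m → Obs p) → ENNReal := fun D =>
    volume {θ : EuclideanSpace ℝ (Fin p) | θ ∈ Metric.ball 0 2 ∧ 1 / 2 ≤ ‖θ‖ ∧
      ∑ i, (inner ℝ (D i).1 θ : ℝ) ^ 2 ≤ Q / 32 * m} with hF
  have hFm : Measurable F := by
    exact measurable_measure_prodMk_left (measurableSet_quadForm_le p m (Q / 32 * m))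
  set V := volume (Metric.ball (0 : EuclideanSpace ℝ (Fin p)) 2) with hV
  have hV0 : V ≠ 0 := (Metric.measure_ball_pos _ _ (by norm_num)).ne'
  have hVtop : V ≠ ⊤ := measure_ball_lt_top.ne
  -- The square root of the expected relative volume exp(-Q m / 4): by Markov, the relative volume
  -- reaches a with probability at most a.
  set a := Real.exp (-(Q / 8 * m)) with ha
  have ha0 : 0 < a := Real.exp_pos _
  set N₁ := {D | ENNReal.ofReal a * V ≤ F D} with hN₁
  set N₂ := {D : Fin m → Obs p | ENNReal.ofReal (2 / η * p * m)
    ≤ ENNReal.ofReal (∑ i, ‖(D i).1‖ ^ 2)} with hN₂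
  have hN₁m : MeasurableSet N₁ := measurableSet_le measurable_const hFm
  have hN₂m : MeasurableSet N₂ := measurableSet_le measurable_const (by fun_prop)
  have hP₁ : Measure.pi (fun _ : Fin m => P) N₁ ≤ ENNReal.ofReal (η / 2) := by
    have h1 := (mul_meas_ge_le_lintegral (μ := Measure.pi fun _ : Fin m => P) hFm
      (ENNReal.ofReal a * V)).trans (h.lintegral_volume_le m)
    have h2 : ENNReal.ofReal (Real.exp (-(Q / 4 * m))) = ENNReal.ofReal a * ENNReal.ofReal a := by
      rw [← ENNReal.ofReal_mul ha0.le, ha, ← Real.exp_add]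
      congr 2; ring
    change ENNReal.ofReal a * V * _ ≤ ENNReal.ofReal (Real.exp (-(Q / 4 * m))) * V at h1
    rw [h2, mul_right_comm _ (ENNReal.ofReal a) V] at h1
    have h3 := (ENNReal.mul_le_mul_iff_right
      (mul_ne_zero (by simpa using ha0) hV0) (ENNReal.mul_ne_top ENNReal.ofReal_ne_top hVtop)).mp h1
    refine h3.trans (ENNReal.ofReal_le_ofReal ?_)
    rw [ha, ← Real.le_log_iff_exp_le (by positivity)]
    have h4 : Real.log (η / 2) = -Real.log (2 / η) := by rw [← Real.log_inv, inv_div]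
    rw [h4]
    have h5 := le_abs_self (Real.log (2 / η))
    nlinarith
  have hP₂ : Measure.pi (fun _ : Fin m => P) N₂ ≤ ENNReal.ofReal (η / 2) := by
    have h1 : ∫⁻ D, ENNReal.ofReal (∑ i, ‖(D i).1‖ ^ 2) ∂(Measure.pi fun _ : Fin m => P)
        = ENNReal.ofReal (p * m) := by
      simp_rw [ENNReal.ofReal_sum_of_nonneg (s := Finset.univ)
        (f := fun i : Fin m => ‖(_ : Fin m → Obs p) i |>.1‖ ^ 2) fun _ _ => sq_nonneg _]
      rw [lintegral_finsetSum _ fun j _ => by fun_prop]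
      have h2 : ∀ i : Fin m, ∫⁻ D : Fin m → Obs p, ENNReal.ofReal (‖(D i).1‖ ^ 2)
          ∂(Measure.pi fun _ : Fin m => P) = ENNReal.ofReal p := fun i => by
        rw [← h.lintegral_norm_sq]
        exact (measurePreserving_eval (fun _ : Fin m => P) i).lintegral_comp
          (f := fun z : Obs p => ENNReal.ofReal (‖z.1‖ ^ 2)) (by fun_prop)
      simp_rw [h2]
      rw [Finset.sum_const, Finset.card_univ, Fintype.card_fin, nsmul_eq_mul, mul_comm,
        ENNReal.ofReal_mul (by positivity), ENNReal.ofReal_natCast m]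
    have h3 := mul_meas_ge_le_lintegral (μ := Measure.pi fun _ : Fin m => P)
      (f := fun D => ENNReal.ofReal (∑ i, ‖(D i).1‖ ^ 2)) (by fun_prop)
      (ENNReal.ofReal (2 / η * p * m))
    rw [h1] at h3
    have h4 : ENNReal.ofReal (p * m) = ENNReal.ofReal (2 / η * p * m) * ENNReal.ofReal (η / 2) := by
      rw [← ENNReal.ofReal_mul (by positivity)]
      congr 1; field_simp
    rw [h4] at h3
    refine (ENNReal.mul_le_mul_iff_right ?_ ENNReal.ofReal_ne_top).mp h3
    have : 0 < 2 / η * p * m := by positivity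
    simpa using this
  refine ⟨N₁ ∪ N₂, hN₁m.union hN₂m, ?_, fun D hD v => ?_⟩
  · refine (measure_union_le _ _).trans ((add_le_add hP₁ hP₂).trans (le_of_eq ?_))
    rw [← ENNReal.ofReal_add (by positivity) (by positivity), add_halves]
  · rw [Set.mem_union, not_or] at hD
    obtain ⟨hD₁, hD₂⟩ := hD
    by_contra! hlt
    have hx : ∑ i, ‖(D i).1‖ ^ 2 ≤ 2 / η * p * m := by
      simp only [hN₂, Set.mem_ofPred_eq, not_le] at hD₂
      exact ((ENNReal.ofReal_lt_ofReal_iff (by positivity)).mp hD₂).le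
    have h1 := volume_ball_le_of_sum_inner_sq_lt hp (fun i => (D i).1) hρ hρ2
      (t := Q / 32 * m) (by positivity) (v := v) (by
        calc ρ ^ 2 * ∑ i, ‖(D i).1‖ ^ 2 ≤ ρ ^ 2 * (2 / η * p * m) := by gcongr
          _ = ρ ^ 2 * (2 / η) * (p * m) := by ring
          _ ≤ Q / 32 / 8 * (p * m) := by gcongr
          _ = _ := by ring) (lt_of_lt_of_eq hlt (by ring))
    simp only [hN₁, Set.mem_ofPred_eq, not_le] at hD₁
    have h2 : volume (Metric.ball (0 : EuclideanSpace ℝ (Fin p)) ρ)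
        < ENNReal.ofReal (2 * a) * V := by
      refine h1.trans_lt ?_
      rw [ENNReal.ofReal_mul (by norm_num), mul_assoc, ENNReal.ofReal_ofNat]
      exact ENNReal.mul_lt_mul_right (by norm_num) (by norm_num) hD₁
    -- Scaling of volume turns the inequality into (ρ/2)^p < 2a, which the choice of C excludes
    -- through p C ≤ Q m / 8.
    have h3 : volume (Metric.ball (0 : EuclideanSpace ℝ (Fin p)) ρ)
        = ENNReal.ofReal ((ρ / 2) ^ p) * V := by
      rw [hV, Measure.addHaar_ball_of_pos _ _ hρ, Measure.addHaar_ball_of_pos _ _ two_pos,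
        finrank_euclideanSpace_fin, ← mul_assoc, ← ENNReal.ofReal_mul (by positivity), ← mul_pow]
      congr 4; ring
    rw [h3] at h2
    have h4 := lt_of_mul_lt_mul_right' h2
    rw [ENNReal.ofReal_lt_ofReal_iff (by positivity), ← Real.log_lt_log_iff (by positivity)
      (by positivity), Real.log_pow, Real.log_mul (by norm_num) ha0.ne', ha, Real.log_exp] at h4
    have h5 : Real.log (ρ / 2) = -Real.log (2 / ρ) := by rw [← Real.log_inv, inv_div]
    rw [h5] at h4
    have h6 := abs_nonneg (Real.log (2 / η))
    nlinarith

/-! ### The truncated score -/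

/-- The second moment of a sum of independent copies of a random vector. -/
theorem integral_norm_sum_sq_le {Ω : Type*} [MeasurableSpace Ω] {P : Measure Ω}
    [IsProbabilityMeasure P] {p m : ℕ} {X : Ω → EuclideanSpace ℝ (Fin p)} (hX : MemLp X 2 P) :
    ∫ D, ‖∑ i, X (D i)‖ ^ 2 ∂(Measure.pi fun _ : Fin m => P)
      ≤ m * ∫ z, ‖X z‖ ^ 2 ∂P + m ^ 2 * ‖∫ z, X z ∂P‖ ^ 2 := by
  set μ := Measure.pi fun _ : Fin m => P
  have hXl : ∀ l, MemLp (fun z => X z l) 2 P := fun l =>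
    hX.continuousLinearMap_comp (EuclideanSpace.proj (𝕜 := ℝ) l)
  have hXi : ∀ l (i : Fin m), MemLp (fun D : Fin m → Ω => X (D i) l) 2 μ := fun l i =>
    (hXl l).comp_measurePreserving (measurePreserving_eval (fun _ : Fin m => P) i)
  have hSl : ∀ l, MemLp (fun D : Fin m → Ω => ∑ i, X (D i) l) 2 μ := fun l =>
    memLp_finsetSum _ fun i _ => hXi l i
  have hEi : ∀ l (i : Fin m), ∫ D, X (D i) l ∂μ = ∫ z, X z l ∂P := fun l i => by
    have hmp := measurePreserving_eval (fun _ : Fin m => P) i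
    have := integral_map (μ := μ) (φ := Function.eval i) hmp.measurable.aemeasurable
      (f := fun z => X z l) (by rw [hmp.map_eq]; exact (hXl l).aestronglyMeasurable)
    rw [hmp.map_eq] at this
    exact this.symm
  have hcoord : ∀ l, ∫ D, (∑ i, X (D i) l) ^ 2 ∂μ
      ≤ m * ∫ z, (X z l) ^ 2 ∂P + m ^ 2 * (∫ z, X z l ∂P) ^ 2 := by
    intro l
    have h1 := ProbabilityTheory.variance_sum_pi (μ := fun _ : Fin m => P)
      (X := fun _ z => X z l) fun _ => hXl l
    have e : (∑ i : Fin m, fun D : Fin m → Ω => X (D i) l) = fun D => ∑ i, X (D i) l := by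
      ext D; simp
    rw [e, ProbabilityTheory.variance_eq_sub (hSl l)] at h1
    have h2 : ∫ D, ∑ i, X (D i) l ∂μ = m * ∫ z, X z l ∂P := by
      rw [integral_finsetSum _ fun i _ => (hXi l i).integrable one_le_two]
      simp [hEi]
    have h3 := ProbabilityTheory.variance_le_expectation_sq (μ := P) (X := fun z => X z l)
      (hXl l).aestronglyMeasurable
    simp only [Finset.sum_const, Finset.card_univ, Fintype.card_fin, nsmul_eq_mul] at h1
    -- Only the variance grows linearly in m; the squared mean enters with m², so a small mean of
    -- the truncated score is essential later.
    have h4 : (m : ℝ) * ProbabilityTheory.variance (fun z => X z l) P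
        ≤ m * ∫ z, (X z l) ^ 2 ∂P := mul_le_mul_of_nonneg_left h3 (by positivity)
    have h5 : ∫ D, (∑ i, X (D i) l) ^ 2 ∂μ = m * ProbabilityTheory.variance (fun z => X z l) P
        + (∫ D, ∑ i, X (D i) l ∂μ) ^ 2 := by
      rw [← h1]
      simp [μ]
    rw [h5, h2]
    nlinarith
  have hmean : ∀ l, (∫ z, X z ∂P) l = ∫ z, X z l ∂P := fun l =>
    ((EuclideanSpace.proj (𝕜 := ℝ) l).integral_comp_comm (hX.integrable one_le_two)).symm
  calc ∫ D, ‖∑ i, X (D i)‖ ^ 2 ∂μ = ∫ D, ∑ l, (∑ i, X (D i) l) ^ 2 ∂μ := by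
        refine integral_congr_ae (.of_forall fun D => ?_)
        simp [EuclideanSpace.real_norm_sq_eq]
    _ = ∑ l, ∫ D, (∑ i, X (D i) l) ^ 2 ∂μ :=
        integral_finsetSum _ fun l _ => (hSl l).integrable_sq
    _ ≤ ∑ l, (m * ∫ z, (X z l) ^ 2 ∂P + m ^ 2 * (∫ z, X z l ∂P) ^ 2) :=
        Finset.sum_le_sum fun l _ => hcoord l
    _ = m * ∫ z, ‖X z‖ ^ 2 ∂P + m ^ 2 * ‖∫ z, X z ∂P‖ ^ 2 := by
        rw [Finset.sum_add_distrib, ← Finset.mul_sum, ← Finset.mul_sum,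
          EuclideanSpace.real_norm_sq_eq]
        simp_rw [EuclideanSpace.real_norm_sq_eq, hmean]
        rw [integral_finsetSum _ fun l _ => (hXl l).integrable_sq]

/-- Observations with moderate noise and moderate covariates. -/
def moderate (p : ℕ) (L : ℝ) : Set (Obs p) := {z | z.2 ^ 2 ≤ L ∧ ‖z.1‖ ^ 2 ≤ L * p}

/-- The score `u x`, truncated to moderate observations. -/
def truncScore {p : ℕ} (L : ℝ) : Obs p → EuclideanSpace ℝ (Fin p) :=
  (moderate p L).indicator fun z => z.2 • z.1

/-- The squared noise of the observations that are not moderate. -/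
def tailNoise {p : ℕ} (L : ℝ) : Obs p → ℝ := (moderate p L)ᶜ.indicator fun z => z.2 ^ 2

theorem measurableSet_moderate (p : ℕ) (L : ℝ) : MeasurableSet (moderate p L) :=
  (measurableSet_le (f := fun z : Obs p => z.2 ^ 2) (by fun_prop) measurable_const).inter
    (measurableSet_le (f := fun z : Obs p => ‖z.1‖ ^ 2) (by fun_prop) measurable_const)

theorem measurable_truncScore {p : ℕ} (L : ℝ) : Measurable (truncScore (p := p) L) :=
  (measurable_snd.smul measurable_fst).indicator (measurableSet_moderate p L)

theorem measurable_tailNoise {p : ℕ} (L : ℝ) : Measurable (tailNoise (p := p) L) :=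
  (measurable_snd.pow_const 2).indicator (measurableSet_moderate p L).compl

theorem tailNoise_nonneg {p : ℕ} (L : ℝ) (z : Obs p) : 0 ≤ tailNoise L z :=
  Set.indicator_nonneg (fun _ _ => sq_nonneg _) _

theorem norm_truncScore_sq_le {p : ℕ} {L : ℝ} (hL : 0 ≤ L) (z : Obs p) :
    ‖truncScore L z‖ ^ 2 ≤ L ^ 2 * p := by
  by_cases hz : z ∈ moderate p L
  · rw [truncScore, Set.indicator_of_mem hz, norm_smul, mul_pow, Real.norm_eq_abs, sq_abs, sq L,
      mul_assoc]
    exact mul_le_mul hz.1 hz.2 (sq_nonneg _) hL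
  · rw [truncScore, Set.indicator_of_notMem hz]
    simp; positivity

/-- The part of the score that is cut off is controlled by the tail noise. -/
theorem exists_score_eq {p : ℕ} (L : ℝ) (z : Obs p) (a : EuclideanSpace ℝ (Fin p)) :
    ∃ t : ℝ, t ^ 2 = tailNoise L z ∧
      z.2 * inner ℝ z.1 a = inner ℝ (truncScore L z) a + t * inner ℝ z.1 a := by
  by_cases hz : z ∈ moderate p L
  · refine ⟨0, ?_, ?_⟩
    · simp [tailNoise, hz]
    · simp [truncScore, hz, inner_smul_left]
  · refine ⟨z.2, ?_, ?_⟩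
    · simp [tailNoise, hz]
    · simp [truncScore, hz]

/-- A bound for the second moment of the noise on observations that are not moderate. -/
def tailBound (r τ s L : ℝ) : ℝ := τ * s * ((s + 1) / L) ^ (1 - 1 / r)

namespace Isotropic

variable {p : ℕ} {P : Measure (Obs p)} {r τ s : ℝ}

theorem memLp_truncScore (h : Isotropic P r τ s) {L : ℝ} (hL : 0 ≤ L) :
    MemLp (truncScore (p := p) L) 2 P := by
  have := h.isProb
  refine MemLp.of_bound (measurable_truncScore L).aestronglyMeasurable (√(L ^ 2 * p))
    (.of_forall fun z => ?_)
  exact Real.le_sqrt_of_sq_le (norm_truncScore_sq_le hL z)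

/-- Markov for u² at level L and for ‖x‖², of mean p, at level L p; the bound does not depend on p.
-/
theorem measure_compl_moderate_le (h : Isotropic P r τ s) (hp : 1 ≤ p) {L : ℝ} (hL : 0 < L) :
    P (moderate p L)ᶜ ≤ ENNReal.ofReal ((s + 1) / L) := by
  have hp0 : (0 : ℝ) < p := by exact_mod_cast hp
  have hs := h.risk_nonneg
  have hsub : (moderate p L)ᶜ ⊆ {z | ENNReal.ofReal L ≤ ENNReal.ofReal (z.2 ^ 2)}
      ∪ {z | ENNReal.ofReal (L * p) ≤ ENNReal.ofReal (‖z.1‖ ^ 2)} := by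
    intro z hz
    simp only [moderate, Set.mem_compl_iff, Set.mem_ofPred_eq, not_and_or, not_le] at hz
    exact hz.imp (fun h => ENNReal.ofReal_le_ofReal h.le) fun h => ENNReal.ofReal_le_ofReal h.le
  have h1 : P {z | ENNReal.ofReal L ≤ ENNReal.ofReal (z.2 ^ 2)} ≤ ENNReal.ofReal (s / L) := by
    refine (meas_ge_le_lintegral_div (by fun_prop) (by simpa using hL)
      ENNReal.ofReal_ne_top).trans ?_
    rw [ENNReal.ofReal_div_of_pos hL]
    gcongr
    rw [← ofReal_integral_eq_lintegral_ofReal h.memLp_y.integrable_sq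
      (.of_forall fun _ => sq_nonneg _)]
    exact ENNReal.ofReal_le_ofReal h.risk
  have h2 : P {z | ENNReal.ofReal (L * p) ≤ ENNReal.ofReal (‖z.1‖ ^ 2)}
      ≤ ENNReal.ofReal (1 / L) := by
    have hLp : 0 < L * p := by positivity
    refine (meas_ge_le_lintegral_div (by fun_prop) (by simpa using hLp)
      ENNReal.ofReal_ne_top).trans ?_
    rw [h.lintegral_norm_sq, ← ENNReal.ofReal_div_of_pos hLp]
    refine ENNReal.ofReal_le_ofReal (le_of_eq ?_)
    field_simp
  calc P (moderate p L)ᶜ ≤ _ := measure_mono hsub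
    _ ≤ _ := measure_union_le _ _
    _ ≤ ENNReal.ofReal (s / L) + ENNReal.ofReal (1 / L) := add_le_add h1 h2
    _ = _ := by rw [← ENNReal.ofReal_add (by positivity) (by positivity), add_div]

theorem integrable_tailNoise (h : Isotropic P r τ s) (L : ℝ) :
    Integrable (tailNoise (p := p) L) P :=
  h.memLp_y.integrable_sq.indicator (measurableSet_moderate p L).compl

theorem lintegral_tailNoise_le (h : Isotropic P r τ s) (hp : 1 ≤ p) {L : ℝ} (hL : 0 < L) :
    ∫⁻ z, ENNReal.ofReal (tailNoise L z) ∂P ≤ ENNReal.ofReal (tailBound r τ s L) := by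
  have hs := h.risk_nonneg
  have hτ := h.one_le
  have hr := h.one_lt
  have hθ : 0 ≤ 1 - 1 / r := by
    rw [sub_nonneg, div_le_one (by linarith)]; exact hr.le
  have e : ∀ z : Obs p, ENNReal.ofReal (tailNoise L z)
      = (moderate p L)ᶜ.indicator (fun z => ENNReal.ofReal (z.2 ^ 2)) z := fun z => by
    by_cases hz : z ∈ (moderate p L)ᶜ <;> simp [tailNoise, hz]
  simp_rw [e]
  rw [lintegral_indicator (measurableSet_moderate p L).compl]
  refine (setLIntegral_ofReal_le h.memLp_y.integrable_sq.aestronglyMeasurable hr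
    h.eLpNorm_noise_le _).trans ?_
  rw [tailBound, ENNReal.ofReal_mul (p := τ * s) (by positivity), ← ENNReal.ofReal_rpow_of_nonneg
    (by positivity) hθ]
  gcongr
  exact h.measure_compl_moderate_le hp hL

theorem integral_tailNoise_le (h : Isotropic P r τ s) (hp : 1 ≤ p) {L : ℝ} (hL : 0 < L) :
    ∫ z, tailNoise L z ∂P ≤ tailBound r τ s L := by
  have hs := h.risk_nonneg
  have hτ := h.one_le
  have h1 := h.lintegral_tailNoise_le hp hL
  rw [← ofReal_integral_eq_lintegral_ofReal (h.integrable_tailNoise L)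
    (.of_forall fun z => tailNoise_nonneg L z)] at h1
  exact (ENNReal.ofReal_le_ofReal_iff (by unfold tailBound; positivity)).mp h1

/-- Test the mean w against itself. As u is orthogonal to ⟨x, w⟩, only the part cut off contributes,
and it is at most half the tail noise plus half of E⟨x, w⟩² = ‖w‖², which is absorbed. -/
theorem norm_integral_truncScore_sq_le (h : Isotropic P r τ s) (hp : 1 ≤ p) {L : ℝ}
    (hL : 0 < L) : ‖∫ z, truncScore L z ∂P‖ ^ 2 ≤ tailBound r τ s L := by
  have := h.isProb
  set w := ∫ z, truncScore L z ∂P with hw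
  have hint : Integrable (truncScore (p := p) L) P := (h.memLp_truncScore hL.le).integrable one_le_two
  have h1 : ∫ z, (inner ℝ w (truncScore L z) : ℝ) ∂P = ‖w‖ ^ 2 := by
    rw [integral_inner hint, ← hw, real_inner_self_eq_norm_sq]
  have h2 : Integrable (fun z : Obs p => z.2 * inner ℝ z.1 w) P :=
    h.memLp_y.integrable_mul (h.memLp_inner w)
  have h3 : ∫ z, (inner ℝ w (truncScore L z) : ℝ) ∂P
      = ∫ z, ((inner ℝ w (truncScore L z) : ℝ) - z.2 * inner ℝ z.1 w) ∂P := by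
    rw [integral_sub (hint.const_inner w) h2, h.orth, sub_zero]
  have h4 : ∫ z, ((inner ℝ w (truncScore L z) : ℝ) - z.2 * inner ℝ z.1 w) ∂P
      ≤ ∫ z, (1 / 2 * tailNoise L z + 1 / 2 * (inner ℝ z.1 w : ℝ) ^ 2) ∂P := by
    refine integral_mono ((hint.const_inner w).sub h2)
      (((h.integrable_tailNoise L).const_mul _).add ((h.integrable_inner_sq w).const_mul _))
      fun z => ?_
    obtain ⟨t, ht, he⟩ := exists_score_eq L z w
    simp only
    rw [real_inner_comm, he, ← ht]
    nlinarith [sq_nonneg (t + inner ℝ z.1 w)]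
  rw [integral_add ((h.integrable_tailNoise L).const_mul _) ((h.integrable_inner_sq w).const_mul _),
    integral_const_mul, integral_const_mul, h.cov] at h4
  linarith [h.integral_tailNoise_le hp hL]

theorem lintegral_norm_sum_truncScore_sq_le (h : Isotropic P r τ s) (hp : 1 ≤ p) {L : ℝ}
    (hL : 0 < L) (m : ℕ) :
    ∫⁻ D, ENNReal.ofReal (‖∑ i, truncScore L (D i)‖ ^ 2) ∂(Measure.pi fun _ : Fin m => P)
      ≤ ENNReal.ofReal (m * (L ^ 2 * p) + m ^ 2 * tailBound r τ s L) := by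
  have := h.isProb
  have hX := h.memLp_truncScore hL.le
  have hint : Integrable (fun D : Fin m → Obs p => ‖∑ i, truncScore L (D i)‖ ^ 2)
      (Measure.pi fun _ : Fin m => P) := by
    have : MemLp (fun D : Fin m → Obs p => ∑ i, truncScore L (D i)) 2
        (Measure.pi fun _ : Fin m => P) :=
      memLp_finsetSum _ fun i _ =>
        hX.comp_measurePreserving (measurePreserving_eval (fun _ : Fin m => P) i)
    exact this.norm.integrable_sq
  rw [← ofReal_integral_eq_lintegral_ofReal hint (.of_forall fun _ => sq_nonneg _)]
  refine ENNReal.ofReal_le_ofReal ((integral_norm_sum_sq_le hX).trans ?_)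
  have h1 : ∫ z, ‖truncScore L z‖ ^ 2 ∂P ≤ L ^ 2 * p := by
    calc _ ≤ ∫ _z, L ^ 2 * p ∂P := by
          refine integral_mono hX.norm.integrable_sq (integrable_const _) fun z =>
            norm_truncScore_sq_le hL.le z
      _ = _ := by simp
  have h2 := h.norm_integral_truncScore_sq_le hp hL
  gcongr

end Isotropic

/-! ### A measurable version of the least squares estimator -/

section OLS

variable {p : ℕ} {ι : Type*} [Fintype ι]

/-- The solution `(Xᵀ X)⁻¹ Xᵀ Y` of the normal equations. -/
def olsEstimator (D : ι → Obs p) : EuclideanSpace ℝ (Fin p) :=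
  WithLp.toLp 2 (((design D).transpose * design D)⁻¹.mulVec
    ((design D).transpose.mulVec fun i => (D i).2))

/-- Cramer's formula: the adjugate is continuous in the data, and only the scalar inverse of the
determinant is merely measurable. -/
theorem measurable_olsEstimator : Measurable (olsEstimator (p := p) (ι := ι)) := by
  have hX : Continuous fun D : ι → Obs p => design D := by
    refine continuous_matrix fun i j => ?_
    simp only [design, Matrix.of_apply]
    fun_prop
  have hG : Continuous fun D : ι → Obs p => (design D).transpose * design D :=
    hX.matrix_transpose.matrix_mul hX
  have hY : Continuous fun D : ι → Obs p => fun i => (D i).2 := by fun_prop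
  have hA : Continuous fun D : ι → Obs p => ((design D).transpose * design D).adjugate.mulVec
      ((design D).transpose.mulVec fun i => (D i).2) :=
    hG.matrix_adjugate.matrix_mulVec (hX.matrix_transpose.matrix_mulVec hY)
  have hdet := hG.matrix_det
  have e : (olsEstimator (p := p) (ι := ι)) = fun D =>
      WithLp.toLp 2 (((design D).transpose * design D).det⁻¹ •
        ((design D).transpose * design D).adjugate.mulVec
          ((design D).transpose.mulVec fun i => (D i).2)) := by
    ext1 D
    rw [olsEstimator, Matrix.inv_def, Ring.inverse_eq_inv', Matrix.smul_mulVec]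
  rw [e]
  exact (PiLp.continuous_toLp 2 _).measurable.comp (hdet.measurable.inv.smul hA.measurable)

/-- This identifies an arbitrary choice of OLS with the measurable one, for which independence of
the omitted fold can be exploited. -/
theorem IsOLS.eq_olsEstimator [Nonempty ι] {D : ι → Obs p} {b : EuclideanSpace ℝ (Fin p)}
    (h : IsOLS D b) (hD : ∀ v, ∑ i, (inner ℝ (D i).1 v) ^ 2 = 0 → v = 0) :
    b = olsEstimator D := by
  have hXv : ∀ v : EuclideanSpace ℝ (Fin p), (design D).mulVec v.ofLp =
      fun i => inner ℝ (D i).1 v := fun v => by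
    ext i
    simp [Matrix.mulVec, dotProduct, design, PiLp.inner_apply, mul_comm]
  set G := (design D).transpose * design D with hG
  have hdet : G.det ≠ 0 := by
    intro h0
    obtain ⟨v, hv0, hv⟩ := Matrix.exists_mulVec_eq_zero_iff.mpr h0
    apply hv0
    have h1 : ∑ i, (inner ℝ (D i).1 (WithLp.toLp 2 v) : ℝ) ^ 2 = 0 := by
      have h2 : v ⬝ᵥ G.mulVec v = 0 := by rw [hv, dotProduct_zero]
      rw [hG, ← Matrix.mulVec_mulVec, Matrix.dotProduct_mulVec, Matrix.vecMul_transpose] at h2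
      rw [← h2, hXv (WithLp.toLp 2 v)]
      simp [dotProduct, sq]
    have := hD _ h1
    simpa using congrArg WithLp.ofLp this
  have hnormal : G.mulVec b.ofLp = (design D).transpose.mulVec fun i => (D i).2 := by
    rw [hG, ← Matrix.mulVec_mulVec, hXv, ← sub_eq_zero, ← Matrix.mulVec_sub]
    ext j
    have h1 := h.normal_eq (EuclideanSpace.single j 1)
    simp only [EuclideanSpace.inner_single_right] at h1
    change _ = (0 : ℝ)
    rw [← neg_eq_zero, ← h1, Matrix.mulVec, dotProduct, ← Finset.sum_neg_distrib]
    refine Finset.sum_congr rfl fun i _ => ?_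
    simp [design]; ring
  rw [olsEstimator, ← hnormal, Matrix.mulVec_mulVec, Matrix.nonsing_inv_mul _ hdet.isUnit,
    Matrix.one_mulVec]

end OLS

/-! ### The folds of an i.i.d. sample -/

section Folds

variable {p K m : ℕ} {P : Measure (Obs p)} [IsProbabilityMeasure P]

instance : IsProbabilityMeasure (sampleLaw P K m) := by
  unfold sampleLaw; infer_instance

theorem measurePreserving_testSet (q : Fin K) :
    MeasurePreserving (fun d : Fin K × Fin m → Obs p => testSet d q) (sampleLaw P K m)
      (Measure.pi fun _ : Fin m => P) := by
  have hm : Measurable fun d : Fin K × Fin m → Obs p => testSet d q := by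
    unfold testSet; fun_prop
  refine ⟨hm, ?_⟩
  have hind : ProbabilityTheory.iIndepFun
      (fun (i : Fin K × Fin m) (d : Fin K × Fin m → Obs p) => d i) (sampleLaw P K m) :=
    ProbabilityTheory.iIndepFun_pi (X := fun _ z => z) fun _ => aemeasurable_id
  have h1 := hind.precomp (g := fun i : Fin m => (q, i)) (Prod.mk_right_injective q)
  rw [ProbabilityTheory.iIndepFun_iff_map_fun_eq_pi_map
    fun i => (measurable_pi_apply _).aemeasurable] at h1
  refine h1.trans ?_
  congr 1
  ext1 i
  exact (measurePreserving_eval (fun _ : Fin K × Fin m => P) (q, i)).map_eq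

/-- The error of an estimator on a fold that was not used for its computation. -/
theorem sampleLaw_testSet_error_le {r τ s : ℝ} (h : Isotropic P r τ s) (k : Fin K) (b : ℝ) {t : ℝ}
    (ht : 0 < t) :
    sampleLaw P K m {d | ‖olsEstimator (trainSet d k)‖ ^ 2 ≤ b ∧
        t ≤ ∑ i, (inner ℝ (d (k, i)).1 (olsEstimator (trainSet d k)) : ℝ) ^ 2}
      ≤ ENNReal.ofReal (m * b / t) := by
  set I := {i : Fin K × Fin m // i.1 ≠ k}
  set I' := {i : Fin K × Fin m // ¬ i.1 ≠ k}
  set F : (I → Obs p) → EuclideanSpace ℝ (Fin p) := fun D =>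
    olsEstimator fun j : {q : Fin K // q ≠ k} × Fin m => D ⟨(j.1.1, j.2), j.1.2⟩ with hF
  have hFm : Measurable F := measurable_olsEstimator.comp (by fun_prop)
  set g : Fin m → I' := fun i => ⟨(k, i), by simp⟩
  set S : Set ((I → Obs p) × (I' → Obs p)) := {x | ‖F x.1‖ ^ 2 ≤ b ∧
    t ≤ ∑ i, (inner ℝ (x.2 (g i)).1 (F x.1) : ℝ) ^ 2} with hS
  have hSm : MeasurableSet S := by
    have h1 : MeasurableSet {x : (I → Obs p) × (I' → Obs p) | ‖F x.1‖ ^ 2 ≤ b} :=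
      measurableSet_le (by fun_prop) measurable_const
    have h2 : MeasurableSet {x : (I → Obs p) × (I' → Obs p) |
        t ≤ ∑ i, (inner ℝ (x.2 (g i)).1 (F x.1) : ℝ) ^ 2} :=
      measurableSet_le measurable_const (by fun_prop)
    exact h1.inter h2
  have hmp := measurePreserving_piEquivPiSubtypeProd (fun _ : Fin K × Fin m => P)
    (fun i => i.1 ≠ k)
  have hpre : {d : Fin K × Fin m → Obs p | ‖olsEstimator (trainSet d k)‖ ^ 2 ≤ b ∧
        t ≤ ∑ i, (inner ℝ (d (k, i)).1 (olsEstimator (trainSet d k)) : ℝ) ^ 2}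
      = MeasurableEquiv.piEquivPiSubtypeProd (fun _ : Fin K × Fin m => Obs p)
          (fun i => i.1 ≠ k) ⁻¹' S := rfl
  rw [hpre, sampleLaw, hmp.measure_preimage hSm.nullMeasurableSet, Measure.prod_apply hSm]
  -- With the training folds frozen, the estimator is a fixed vector F D and the omitted fold is a
  -- fresh sample; Markov applies with mean m ‖F D‖² ≤ m b.
  have hsec : ∀ D : I → Obs p, Measure.pi (fun _ : I' => P) (Prod.mk D ⁻¹' S)
      ≤ ENNReal.ofReal (m * b / t) := by
    intro D
    by_cases hD : ‖F D‖ ^ 2 ≤ b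
    · have h1 : Prod.mk D ⁻¹' S ⊆ {x : I' → Obs p | ENNReal.ofReal t
          ≤ ∑ i, ENNReal.ofReal ((inner ℝ (x (g i)).1 (F D) : ℝ) ^ 2)} := by
        intro x hx
        have hx2 : t ≤ ∑ i, (inner ℝ (x (g i)).1 (F D) : ℝ) ^ 2 := hx.2
        simp only [Set.mem_ofPred_eq]
        rw [← ENNReal.ofReal_sum_of_nonneg fun _ _ => sq_nonneg _]
        exact ENNReal.ofReal_le_ofReal hx2
      refine (measure_mono h1).trans ?_
      refine (meas_ge_le_lintegral_div (Measurable.aemeasurable (by fun_prop)) (by simpa using ht)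
        ENNReal.ofReal_ne_top).trans ?_
      rw [ENNReal.ofReal_div_of_pos ht, lintegral_finsetSum _ fun i _ => by fun_prop]
      gcongr
      have h2 : ∀ i : Fin m, ∫⁻ x : I' → Obs p, ENNReal.ofReal ((inner ℝ (x (g i)).1 (F D) : ℝ) ^ 2)
          ∂(Measure.pi fun _ : I' => P) = ENNReal.ofReal (‖F D‖ ^ 2) := fun i => by
        rw [← h.lintegral_inner_sq]
        exact (measurePreserving_eval (fun _ : I' => P) (g i)).lintegral_comp
          (f := fun z : Obs p => ENNReal.ofReal ((inner ℝ z.1 (F D) : ℝ) ^ 2)) (by fun_prop)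
      simp_rw [h2]
      rw [Finset.sum_const, Finset.card_univ, Fintype.card_fin, nsmul_eq_mul,
        ENNReal.ofReal_mul (by positivity), ENNReal.ofReal_natCast m]
      gcongr
    · have : Prod.mk D ⁻¹' S = ∅ := by
        ext x
        simp only [hS, Set.mem_preimage, Set.mem_ofPred_eq, Set.mem_empty_iff_false, iff_false]
        exact fun hc => hD hc.1
      rw [this, measure_empty]
      exact zero_le
  calc _ ≤ ∫⁻ _D, ENNReal.ofReal (m * b / t) ∂(Measure.pi fun _ : I => P) :=
        lintegral_mono fun D => hsec D
    _ = _ := by simp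

end Folds

/-! ### Deterministic consequences of controlled samples -/

theorem sq_sum_score_le {p : ℕ} {ι : Type*} (I : Finset ι) (D : ι → Obs p) (L : ℝ)
    (a : EuclideanSpace ℝ (Fin p)) :
    (∑ i ∈ I, (D i).2 * inner ℝ (D i).1 a) ^ 2 ≤
      2 * (‖∑ i ∈ I, truncScore L (D i)‖ ^ 2 * ‖a‖ ^ 2)
        + 2 * ((∑ i ∈ I, tailNoise L (D i)) * ∑ i ∈ I, (inner ℝ (D i).1 a : ℝ) ^ 2) := by
  choose t ht he using fun i => exists_score_eq L (D i) a
  have h1 : ∑ i ∈ I, (D i).2 * inner ℝ (D i).1 a =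
      inner ℝ (∑ i ∈ I, truncScore L (D i)) a + ∑ i ∈ I, t i * inner ℝ (D i).1 a := by
    rw [sum_inner, ← Finset.sum_add_distrib]
    exact Finset.sum_congr rfl fun i _ => he i
  have h2 : (∑ i ∈ I, t i * inner ℝ (D i).1 a) ^ 2
      ≤ (∑ i ∈ I, tailNoise L (D i)) * ∑ i ∈ I, (inner ℝ (D i).1 a : ℝ) ^ 2 := by
    simp_rw [← ht]
    exact Finset.sum_mul_sq_le_sq_mul_sq I t fun i => (inner ℝ (D i).1 a : ℝ)
  have h3 : (inner ℝ (∑ i ∈ I, truncScore L (D i)) a : ℝ) ^ 2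
      ≤ ‖∑ i ∈ I, truncScore L (D i)‖ ^ 2 * ‖a‖ ^ 2 := by
    rw [← mul_pow, ← sq_abs]
    gcongr
    exact abs_real_inner_le_norm _ _
  rw [h1]
  nlinarith [sq_nonneg ((inner ℝ (∑ i ∈ I, truncScore L (D i)) a : ℝ)
    - ∑ i ∈ I, t i * inner ℝ (D i).1 a)]

/-- The empirical Gram matrix of a sample of size `n` is bounded below by `c`, and the empirical
score is at most `√γ`, relative to the empirical norm. -/
def Controlled {p : ℕ} {ι : Type*} [Fintype ι] (D : ι → Obs p) (n c γ : ℝ) : Prop :=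
  ∀ a : EuclideanSpace ℝ (Fin p), c * n * ‖a‖ ^ 2 ≤ ∑ i, (inner ℝ (D i).1 a : ℝ) ^ 2 ∧
    (∑ i, (D i).2 * inner ℝ (D i).1 a) ^ 2 ≤ γ * n * ∑ i, (inner ℝ (D i).1 a : ℝ) ^ 2

namespace Controlled

variable {p : ℕ} {ι : Type*} [Fintype ι] {D : ι → Obs p} {n c γ : ℝ}

theorem definite (h : Controlled D n c γ) (hn : 0 < n) (hc : 0 < c)
    (v : EuclideanSpace ℝ (Fin p)) (hv : ∑ i, (inner ℝ (D i).1 v : ℝ) ^ 2 = 0) : v = 0 := by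
  have h1 := (h v).1
  rw [hv] at h1
  by_contra hv0
  have : 0 < ‖v‖ := norm_pos_iff.mpr hv0
  exact absurd h1 (not_le.mpr (by positivity))

theorem sum_sq_le_of_isOLS [Nonempty ι] (h : Controlled D n c γ) (hn : 0 < n) (hγ : 0 < γ)
    {a : EuclideanSpace ℝ (Fin p)} (ha : IsOLS D a) :
    ∑ i, (inner ℝ (D i).1 a : ℝ) ^ 2 ≤ γ * n := by
  have h1 := ha.normal_eq a
  have h2 := (h a).2
  have h3 : ∑ i, (D i).2 * inner ℝ (D i).1 a = ∑ i, (inner ℝ (D i).1 a : ℝ) ^ 2 := by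
    rw [← sub_eq_zero, ← h1, ← Finset.sum_sub_distrib]
    refine Finset.sum_congr rfl fun i _ => by ring
  rw [h3, sq] at h2
  by_contra! hlt
  have h4 : 0 < ∑ i, (inner ℝ (D i).1 a : ℝ) ^ 2 := lt_trans (by positivity) hlt
  exact absurd (le_of_mul_le_mul_right h2 h4) (not_le.mpr hlt)

theorem norm_sq_le (h : Controlled D n c γ) (hn : 0 < n) (hc : 0 < c)
    {a : EuclideanSpace ℝ (Fin p)} {θ : ℝ}
    (ha : ∑ i, (inner ℝ (D i).1 a : ℝ) ^ 2 ≤ θ * n) : ‖a‖ ^ 2 ≤ θ / c := by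
  rw [le_div_iff₀ hc]
  have := (h a).1
  nlinarith

/-- A vector whose empirical risk is at most that of a small vector is small. -/
theorem norm_sq_le_of_risk_le (h : Controlled D n c γ) (hn : 0 < n) (hc : 0 < c) (hγ : 0 < γ)
    {a a' : EuclideanSpace ℝ (Fin p)} {θ : ℝ}
    (ha : ∑ i, (inner ℝ (D i).1 a : ℝ) ^ 2 ≤ θ * n)
    (hle : ∑ i, ((D i).2 - inner ℝ (D i).1 a') ^ 2 ≤ ∑ i, ((D i).2 - inner ℝ (D i).1 a) ^ 2) :
    ‖a'‖ ^ 2 ≤ (4 * θ + 6 * γ) / c := by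
  have e : ∀ b : EuclideanSpace ℝ (Fin p), ∑ i, ((D i).2 - inner ℝ (D i).1 b) ^ 2 =
      ∑ i, (D i).2 ^ 2 - 2 * ∑ i, (D i).2 * inner ℝ (D i).1 b
        + ∑ i, (inner ℝ (D i).1 b : ℝ) ^ 2 := fun b => by
    simpa using sum_sq_residual_add D 0 b
  rw [e, e] at hle
  have h1 := (h a).2
  have h2 := (h a').2
  set S := ∑ i, (D i).2 * inner ℝ (D i).1 a
  set S' := ∑ i, (D i).2 * inner ℝ (D i).1 a'
  set T := ∑ i, (inner ℝ (D i).1 a : ℝ) ^ 2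
  set T' := ∑ i, (inner ℝ (D i).1 a' : ℝ) ^ 2
  have hT : 0 ≤ T := Finset.sum_nonneg fun _ _ => sq_nonneg _
  have hT' : 0 ≤ T' := Finset.sum_nonneg fun _ _ => sq_nonneg _
  have hγn : 0 < γ * n := by positivity
  -- Half of T' stays on the left after this arithmetic–geometric bound; together with the next one
  -- it yields T' ≤ 4 T + 6 γ n.
  have h3 : 2 * S' ≤ 1 / 2 * T' + 2 * (γ * n) := by
    refine le_of_sq_le_sq ?_ (by positivity)
    nlinarith [sq_nonneg (1 / 2 * T' - 2 * (γ * n))]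
  have h4 : -(2 * S) ≤ T + γ * n := by
    refine le_of_sq_le_sq ?_ (by positivity)
    nlinarith [sq_nonneg (T - γ * n)]
  exact h.norm_sq_le hn hc (by linarith)

end Controlled

/-! ### From bounds on most folds to the full sample and the training sets -/

section Folds

variable {p K m : ℕ}

/-- Bounds on the folds of a sample yield bounds on unions of folds. -/
theorem sum_folds_controlled {d : Fin K × Fin m → Obs p} {c α L : ℝ} (hc : 0 < c) (hα : 0 < α)
    {Bad : Finset (Fin K)}
    (hgood : ∀ q ∉ Bad, ∀ a, 2 * c * m * ‖a‖ ^ 2 ≤ ∑ i, (inner ℝ (d (q, i)).1 a : ℝ) ^ 2)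
    (htr : ∑ q, ‖∑ i, truncScore L (d (q, i))‖ ^ 2 ≤ K * m ^ 2 * α / 2)
    (htl : ∑ q, ∑ i, tailNoise L (d (q, i)) ≤ K * m * α / 2)
    {J : Finset (Fin K)} (hJ : J.card ≤ 2 * (J \ Bad).card) (hKJ : K ≤ 2 * J.card)
    (a : EuclideanSpace ℝ (Fin p)) :
    c * (J.card * m) * ‖a‖ ^ 2 ≤ ∑ q ∈ J, ∑ i, (inner ℝ (d (q, i)).1 a : ℝ) ^ 2 ∧
      (∑ q ∈ J, ∑ i, (d (q, i)).2 * inner ℝ (d (q, i)).1 a) ^ 2 ≤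
        2 * α * (1 / c + 1) * (J.card * m)
          * ∑ q ∈ J, ∑ i, (inner ℝ (d (q, i)).1 a : ℝ) ^ 2 := by
  have hJ' : (J.card : ℝ) ≤ 2 * (J \ Bad).card := by exact_mod_cast hJ
  have hKJ' : (K : ℝ) ≤ 2 * J.card := by exact_mod_cast hKJ
  set T := ∑ q ∈ J, ∑ i, (inner ℝ (d (q, i)).1 a : ℝ) ^ 2 with hT
  have hT0 : 0 ≤ T := Finset.sum_nonneg fun _ _ => Finset.sum_nonneg fun _ _ => sq_nonneg _
  have hlow : c * (J.card * m) * ‖a‖ ^ 2 ≤ T := by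
    calc c * (J.card * m) * ‖a‖ ^ 2 = J.card * (c * m * ‖a‖ ^ 2) := by ring
      _ ≤ 2 * (J \ Bad).card * (c * m * ‖a‖ ^ 2) := by gcongr
      _ = ∑ _q ∈ J \ Bad, 2 * c * m * ‖a‖ ^ 2 := by
          rw [Finset.sum_const, nsmul_eq_mul]; ring
      _ ≤ ∑ q ∈ J \ Bad, ∑ i, (inner ℝ (d (q, i)).1 a : ℝ) ^ 2 :=
          Finset.sum_le_sum fun q hq => hgood q (Finset.mem_sdiff.mp hq).2 a
      _ ≤ T := Finset.sum_le_sum_of_subset_of_nonneg Finset.sdiff_subset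
          fun _ _ _ => Finset.sum_nonneg fun _ _ => sq_nonneg _
  refine ⟨hlow, ?_⟩
  have h1 := sq_sum_score_le (J ×ˢ (Finset.univ : Finset (Fin m))) d L a
  simp only [Finset.sum_product] at h1
  refine h1.trans ?_
  -- Cauchy–Schwarz over the folds; since K ≤ 2 |J|, bounds summed over all folds cost only a factor
  -- 2 on J.
  have h2 : ‖∑ q ∈ J, ∑ i, truncScore L (d (q, i))‖ ^ 2 ≤ J.card ^ 2 * m ^ 2 * α := by
    calc ‖∑ q ∈ J, ∑ i, truncScore L (d (q, i))‖ ^ 2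
        ≤ (∑ q ∈ J, ‖∑ i, truncScore L (d (q, i))‖) ^ 2 := by
          gcongr; exact norm_sum_le _ _
      _ ≤ J.card * ∑ q ∈ J, ‖∑ i, truncScore L (d (q, i))‖ ^ 2 := sq_sum_le_card_mul_sum_sq
      _ ≤ J.card * (K * m ^ 2 * α / 2) := by
          gcongr
          exact (Finset.sum_le_univ_sum_of_nonneg fun _ => sq_nonneg _).trans htr
      _ ≤ J.card * (2 * J.card * m ^ 2 * α / 2) := by gcongr
      _ = _ := by ring
  have h3 : ∑ q ∈ J, ∑ i, tailNoise L (d (q, i)) ≤ J.card * m * α := by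
    calc _ ≤ K * m * α / 2 := (Finset.sum_le_univ_sum_of_nonneg fun _ =>
          Finset.sum_nonneg fun _ _ => tailNoise_nonneg _ _).trans htl
      _ ≤ 2 * J.card * m * α / 2 := by gcongr
      _ = _ := by ring
  have h4 : (J.card * m : ℝ) * ‖a‖ ^ 2 ≤ T / c := by
    rw [le_div_iff₀ hc]; linarith
  calc _ ≤ 2 * (J.card ^ 2 * m ^ 2 * α * ‖a‖ ^ 2) + 2 * (J.card * m * α * T) := by gcongr
    _ = 2 * (J.card * m * α) * (J.card * m * ‖a‖ ^ 2) + 2 * (J.card * m * α * T) := by ring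
    _ ≤ 2 * (J.card * m * α) * (T / c) + 2 * (J.card * m * α * T) := by gcongr
    _ = _ := by field_simp

/-- If fewer than half of the folds are bad, then the full sample and all training sets are
controlled. -/
theorem controlled_of_folds (hK : 2 ≤ K) {d : Fin K × Fin m → Obs p} {c α L : ℝ} (hc : 0 < c)
    (hα : 0 < α) {Bad : Finset (Fin K)} (hBad : 2 * Bad.card < K)
    (hgood : ∀ q ∉ Bad, ∀ a, 2 * c * m * ‖a‖ ^ 2 ≤ ∑ i, (inner ℝ (d (q, i)).1 a : ℝ) ^ 2)
    (htr : ∑ q, ‖∑ i, truncScore L (d (q, i))‖ ^ 2 ≤ K * m ^ 2 * α / 2)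
    (htl : ∑ q, ∑ i, tailNoise L (d (q, i)) ≤ K * m * α / 2) :
    Controlled d (K * m) c (2 * α * (1 / c + 1)) ∧
      ∀ k, Controlled (trainSet d k) ((K - 1) * m) c (2 * α * (1 / c + 1)) := by
  have hgen := fun J => sum_folds_controlled hc hα hgood htr htl (J := J)
  constructor
  · intro a
    have hcard : (Finset.univ \ Bad).card + Bad.card = K := by
      rw [Finset.card_sdiff_add_card_eq_card (Finset.subset_univ _), Finset.card_univ,
        Fintype.card_fin]
    have h1 := hgen Finset.univ (by rw [Finset.card_univ, Fintype.card_fin]; omega)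
      (by rw [Finset.card_univ, Fintype.card_fin]; omega) a
    rw [Finset.card_univ, Fintype.card_fin] at h1
    rwa [← Fintype.sum_prod_type (fun i => (inner ℝ (d i).1 a : ℝ) ^ 2),
      ← Fintype.sum_prod_type (fun i => (d i).2 * (inner ℝ (d i).1 a : ℝ))] at h1
  · intro k a
    have hc1 : (Finset.univ.erase k).card = K - 1 := by
      rw [Finset.card_erase_of_mem (Finset.mem_univ _), Finset.card_univ, Fintype.card_fin]
    have hc2 := Finset.le_card_sdiff Bad (Finset.univ.erase k)
    rw [hc1] at hc2
    have h1 := hgen (Finset.univ.erase k) (by rw [hc1]; omega) (by rw [hc1]; omega) a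
    rw [hc1, Nat.cast_sub (by omega), Nat.cast_one] at h1
    rwa [sum_trainSet d k (fun z => (inner ℝ z.1 a : ℝ) ^ 2),
      sum_trainSet d k (fun z => z.2 * (inner ℝ z.1 a : ℝ))]

/-- Least squares on a training set, and everything that beats it in cross-validation, is small
if the samples are controlled and least squares does well on the fold that was left out. -/
theorem norm_sq_le_of_controlled (hK : 2 ≤ K) (hm : 1 ≤ m) {d : Fin K × Fin m → Obs p}
    {c γ ε : ℝ} (hc : 0 < c) (hγ : 0 < γ) (hd : Controlled d (K * m) c γ) (k : Fin K)
    (hk : Controlled (trainSet d k) ((K - 1) * m) c γ)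
    (hout : ¬ (‖olsEstimator (trainSet d k)‖ ^ 2 ≤ γ / c ∧
      ε * (K * m) ≤ ∑ i, (inner ℝ (d (k, i)).1 (olsEstimator (trainSet d k)) : ℝ) ^ 2))
    {a : EuclideanSpace ℝ (Fin p)} (ha : IsOLS (trainSet d k) a) :
    ‖a‖ ^ 2 ≤ γ / c ∧ ∀ a', cvError d a' ≤ cvError d a → ‖a'‖ ^ 2 ≤ (10 * γ + 4 * ε) / c := by
  have : Nontrivial (Fin K) := Fin.nontrivial_iff_two_le.mpr hK
  have : Nonempty ({q : Fin K // q ≠ k} × Fin m) := by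
    obtain ⟨q, hq⟩ := exists_ne k
    exact ⟨⟨q, hq⟩, ⟨0, by omega⟩⟩
  have hK' : (2 : ℝ) ≤ K := by exact_mod_cast hK
  have hm' : (1 : ℝ) ≤ m := by exact_mod_cast hm
  have hn : 0 < ((K : ℝ) - 1) * m := mul_pos (by linarith) (by linarith)
  have hn' : 0 < (K : ℝ) * m := mul_pos (by linarith) (by linarith)
  have h1 := hk.sum_sq_le_of_isOLS hn hγ ha
  have h2 := hk.norm_sq_le hn hc h1
  refine ⟨h2, fun a' ha' => ?_⟩
  rw [← ha.eq_olsEstimator (hk.definite hn hc)] at hout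
  have h3 : ∑ i, (inner ℝ (d (k, i)).1 a : ℝ) ^ 2 ≤ ε * (K * m) := by
    by_contra! hlt
    exact hout ⟨h2, hlt.le⟩
  -- The training folds contribute at most γ (K - 1) m and the omitted fold at most ε K m. The risk
  -- comparison then gives 4 (γ + ε) + 6 γ = 10 γ + 4 ε.
  have h4 : ∑ i, (inner ℝ (d i).1 a : ℝ) ^ 2 ≤ (γ + ε) * (K * m) := by
    rw [sum_trainSet d k (fun z => (inner ℝ z.1 a : ℝ) ^ 2)] at h1
    rw [Fintype.sum_prod_type, ← Finset.add_sum_erase _ _ (Finset.mem_univ k)]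
    nlinarith
  rw [cvError_eq, cvError_eq] at ha'
  have h5 := hd.norm_sq_le_of_risk_le hn' hc hγ h4 (le_of_mul_le_mul_left ha' (by positivity))
  refine h5.trans (le_of_eq ?_)
  ring

end Folds

/-! ### Consistency for isotropic designs -/

/-- Markov's inequality for a sum over folds. -/
theorem sampleLaw_sum_folds_ge_le {p K m : ℕ} {P : Measure (Obs p)} [IsProbabilityMeasure P]
    (hK : 1 ≤ K) {g : (Fin m → Obs p) → ENNReal} (hg : Measurable g) {A t : ℝ}
    (hA : ∫⁻ D, g D ∂(Measure.pi fun _ : Fin m => P) ≤ ENNReal.ofReal A) (ht : 0 < t) :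
    sampleLaw P K m {d | ENNReal.ofReal (K * t) ≤ ∑ q, g (testSet d q)}
      ≤ ENNReal.ofReal (A / t) := by
  have hK0 : (0 : ℝ) < K := by exact_mod_cast hK
  have hKt : 0 < K * t := by positivity
  have hgm : ∀ q : Fin K, Measurable fun d : Fin K × Fin m → Obs p => g (testSet d q) :=
    fun q => hg.comp (measurePreserving_testSet (P := P) q).measurable
  refine (meas_ge_le_lintegral_div (Finset.measurable_sum _ fun q _ => hgm q).aemeasurable
    (ENNReal.ofReal_pos.mpr hKt).ne' ENNReal.ofReal_ne_top).trans ?_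
  rw [lintegral_finsetSum _ fun q _ => hgm q]
  calc _ ≤ (∑ _q : Fin K, ENNReal.ofReal A) / ENNReal.ofReal (K * t) := by
        gcongr with q
        exact ((measurePreserving_testSet q).lintegral_comp hg).le.trans hA
    _ = _ := by
        rw [Finset.sum_const, Finset.card_univ, Fintype.card_fin, nsmul_eq_mul,
          ← ENNReal.ofReal_natCast, ← ENNReal.ofReal_mul hK0.le, ← ENNReal.ofReal_div_of_pos hKt,
          mul_div_mul_left _ _ hK0.ne']

/-- This is where r > 1 enters: the Hölder exponent 1 - 1/r is positive, so truncation is negligible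
at a level depending only on r, τ and s. -/
theorem tendsto_tailBound {r : ℝ} (hr : 1 < r) (τ s : ℝ) :
    Tendsto (tailBound r τ s) atTop (𝓝 0) := by
  have hθ : 0 < 1 - 1 / r := by
    rw [sub_pos, div_lt_one (by linarith)]; exact hr
  have h1 : Tendsto (fun L : ℝ => (s + 1) / L) atTop (𝓝 0) :=
    tendsto_const_nhds.div_atTop tendsto_id
  have h2 := (h1.rpow_const (Or.inr hθ.le)).const_mul (τ * s)
  rw [Real.zero_rpow hθ.ne', mul_zero] at h2
  exact h2

/-- Markov over the folds, applied to the number of bad folds (level K/2), the squared truncated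
scores and the tail noise. The averages over folds have bounds free of K, so the probability does
not deteriorate as K grows. -/
theorem Isotropic.sampleLaw_not_controlled_le {p K m : ℕ} {P : Measure (Obs p)} {r τ s : ℝ}
    (h : Isotropic P r τ s) (hp : 1 ≤ p) (hK : 2 ≤ K) (hm : 1 ≤ m) {N₀ : Set (Fin m → Obs p)}
    (hN₀ : MeasurableSet N₀) {η c α L : ℝ} (hc : 0 < c) (hα : 0 < α) (hL : 0 < L)
    (hη : Measure.pi (fun _ : Fin m => P) N₀ ≤ ENNReal.ofReal η)
    (hgood : ∀ D ∉ N₀, ∀ a, 2 * c * m * ‖a‖ ^ 2 ≤ ∑ i, (inner ℝ (D i).1 a : ℝ) ^ 2) :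
    ∃ N : Set (Fin K × Fin m → Obs p),
      sampleLaw P K m N ≤ ENNReal.ofReal (2 * η)
        + ENNReal.ofReal (2 * (L ^ 2 * p / m + tailBound r τ s L) / α)
        + ENNReal.ofReal (2 * tailBound r τ s L / α) ∧
      ∀ d ∉ N, Controlled d (K * m) c (2 * α * (1 / c + 1)) ∧
        ∀ k, Controlled (trainSet d k) ((K - 1) * m) c (2 * α * (1 / c + 1)) := by
  classical
  have := h.isProb
  have hm0 : (0 : ℝ) < m := by exact_mod_cast hm
  have hK0 : (0 : ℝ) < K := by exact_mod_cast (by omega : 0 < K)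
  set g₁ : (Fin m → Obs p) → ENNReal := N₀.indicator 1 with hg₁
  set g₂ : (Fin m → Obs p) → ENNReal :=
    fun D => ENNReal.ofReal (‖∑ i, truncScore L (D i)‖ ^ 2) with hg₂
  set g₃ : (Fin m → Obs p) → ENNReal := fun D => ∑ i, ENNReal.ofReal (tailNoise L (D i)) with hg₃
  have hmt := measurable_truncScore (p := p) L
  have hmn := measurable_tailNoise (p := p) L
  have hm₁ : Measurable g₁ := measurable_one.indicator hN₀
  have hm₂ : Measurable g₂ := by fun_prop
  have hm₃ : Measurable g₃ := by fun_prop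
  have hA₁ : ∫⁻ D, g₁ D ∂(Measure.pi fun _ : Fin m => P) ≤ ENNReal.ofReal η := by
    rw [hg₁, lintegral_indicator_one hN₀]; exact hη
  have hA₃ : ∫⁻ D, g₃ D ∂(Measure.pi fun _ : Fin m => P)
      ≤ ENNReal.ofReal (m * tailBound r τ s L) := by
    rw [hg₃, lintegral_finsetSum _ fun i _ => by fun_prop, ENNReal.ofReal_mul hm0.le,
      ENNReal.ofReal_natCast]
    refine (Finset.sum_le_sum (g := fun _ => ENNReal.ofReal (tailBound r τ s L))
      fun i _ => ?_).trans (by simp)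
    exact ((measurePreserving_eval (fun _ : Fin m => P) i).lintegral_comp
      (f := fun z : Obs p => ENNReal.ofReal (tailNoise L z)) (by fun_prop)).le.trans
        (h.lintegral_tailNoise_le hp hL)
  have h₁ := sampleLaw_sum_folds_ge_le (by omega : 1 ≤ K) hm₁ hA₁ (t := 1 / 2) (by norm_num)
  have h₂ := sampleLaw_sum_folds_ge_le (by omega : 1 ≤ K) hm₂
    (h.lintegral_norm_sum_truncScore_sq_le hp hL m) (t := m ^ 2 * α / 2) (by positivity)
  have h₃ := sampleLaw_sum_folds_ge_le (by omega : 1 ≤ K) hm₃ hA₃ (t := m * α / 2) (by positivity)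
  have e₁ : η / (1 / 2) = 2 * η := by ring
  have e₂ : (m * (L ^ 2 * p) + m ^ 2 * tailBound r τ s L) / (m ^ 2 * α / 2)
      = 2 * (L ^ 2 * p / m + tailBound r τ s L) / α := by field_simp
  have e₃ : m * tailBound r τ s L / (m * α / 2) = 2 * tailBound r τ s L / α := by field_simp
  rw [e₁] at h₁
  rw [e₂] at h₂
  rw [e₃] at h₃
  refine ⟨_, (measure_union_le _ _).trans (add_le_add ((measure_union_le _ _).trans
    (add_le_add h₁ h₂)) h₃), fun d hd => ?_⟩
  simp only [Set.mem_union, not_or, Set.mem_ofPred_eq, not_le] at hd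
  obtain ⟨⟨hd₁, hd₂⟩, hd₃⟩ := hd
  refine controlled_of_folds hK hc hα (Bad := Finset.univ.filter fun q => testSet d q ∈ N₀)
    (L := L) ?_ ?_ ?_ ?_
  · have e : ∑ q, g₁ (testSet d q)
        = ENNReal.ofReal (Finset.univ.filter fun q => testSet d q ∈ N₀).card := by
      rw [ENNReal.ofReal_natCast, Finset.card_filter, Nat.cast_sum]
      refine Finset.sum_congr rfl fun q _ => ?_
      by_cases hq : testSet d q ∈ N₀ <;> simp [hg₁, hq]
    rw [e, ENNReal.ofReal_lt_ofReal_iff (by positivity)] at hd₁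
    have : (2 : ℝ) * (Finset.univ.filter fun q => testSet d q ∈ N₀).card < K := by linarith
    exact_mod_cast this
  · intro q hq a
    exact hgood (testSet d q) (by simpa using hq) a
  · rw [← ENNReal.ofReal_sum_of_nonneg fun _ _ => sq_nonneg _,
      ENNReal.ofReal_lt_ofReal_iff (by positivity)] at hd₂
    refine le_of_lt (lt_of_lt_of_eq hd₂ (by ring))
  · simp only [hg₃] at hd₃
    simp_rw [← ENNReal.ofReal_sum_of_nonneg (fun _ _ => tailNoise_nonneg L _)] at hd₃
    rw [← ENNReal.ofReal_sum_of_nonneg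
      fun _ _ => Finset.sum_nonneg fun _ _ => tailNoise_nonneg L _,
      ENNReal.ofReal_lt_ofReal_iff (by positivity)] at hd₃
    refine le_of_lt (lt_of_lt_of_eq hd₃ (by ring))

/-- Consistency of least squares on the training sets, and of everything that beats it in
cross-validation, with uniform constants. -/
theorem exists_isotropic_consistency {r τ s δ η : ℝ} (hr : 1 < r) (hτ : 1 ≤ τ)
    (hδ : 0 < δ) (hη : 0 < η) :
    ∃ κ > 0, ∀ (p K m : ℕ) (P : Measure (Obs p)), 1 ≤ p → 2 ≤ K → 1 ≤ m → (p : ℝ) ≤ κ * m →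
      Isotropic P r τ s → ∃ N : Set (Fin K × Fin m → Obs p),
        sampleLaw P K m N ≤ ENNReal.ofReal η ∧ ∀ d ∉ N, ∀ k a, IsOLS (trainSet d k) a →
          ‖a‖ ^ 2 ≤ δ ∧ ∀ a', cvError d a' ≤ cvError d a → ‖a'‖ ^ 2 ≤ δ := by
  -- Half of the constant 1/128 of `exists_gram_lower`, as up to half of the folds in a union may be
  -- bad.
  set c := smallBallConst r τ / 256 with hc_def
  have hc : 0 < c := div_pos (smallBallConst_pos (by linarith)) (by norm_num)
  set ε := c * δ / 8 with hε_def
  have hε : 0 < ε := by positivity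
  -- The first bound makes 10 γ / c ≤ δ/2, matching 4 ε / c = δ/2; the second makes the union over
  -- omitted folds cost at most η/4.
  obtain ⟨γ, hγ, hγ1, hγ2⟩ : ∃ γ : ℝ, 0 < γ ∧ γ ≤ c * δ / 20 ∧ γ ≤ c * ε * η / 4 :=
    ⟨min (c * δ / 20) (c * ε * η / 4), by positivity, min_le_left _ _, min_le_right _ _⟩
  set α := γ / (2 * (1 / c + 1)) with hα_def
  have hα : 0 < α := by positivity
  have hαγ : 2 * α * (1 / c + 1) = γ := by rw [hα_def]; field_simp
  obtain ⟨L, hL, hLν⟩ : ∃ L : ℝ, 0 < L ∧ tailBound r τ s L ≤ α * η / 16 := by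
    have h1 := (tendsto_tailBound hr τ s).eventually_le_const
      (u := α * η / 16) (by positivity)
    obtain ⟨L, hL1, hL2⟩ := (h1.and (eventually_gt_atTop 0)).exists
    exact ⟨L, hL2, hL1⟩
  obtain ⟨κ, hκ, hgram⟩ := exists_gram_lower r hτ (η := η / 8) (by positivity)
  refine ⟨min κ (α * η / (8 * L ^ 2)), by positivity, fun p K m P hp hK hm hpm h => ?_⟩
  have := h.isProb
  have hm0 : (0 : ℝ) < m := by exact_mod_cast hm
  have hK0 : (0 : ℝ) < K := by exact_mod_cast (by omega : 0 < K)
  obtain ⟨N₀, hN₀, hN₀η, hN₀good⟩ := hgram p m P s hp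
    (hpm.trans (by gcongr; exact min_le_left _ _)) h
  obtain ⟨N, hN, hNc⟩ := h.sampleLaw_not_controlled_le hp hK hm hN₀ hc hα hL hN₀η
    (fun D hD a => by
      have h1 := hN₀good D hD a
      have e : 2 * c = smallBallConst r τ / 128 := by rw [hc_def]; ring
      rwa [e])
  rw [hαγ] at hNc
  set M : Fin K → Set (Fin K × Fin m → Obs p) := fun k =>
    {d | ‖olsEstimator (trainSet d k)‖ ^ 2 ≤ γ / c ∧ ε * (K * m) ≤
      ∑ i, (inner ℝ (d (k, i)).1 (olsEstimator (trainSet d k)) : ℝ) ^ 2} with hM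
  have hMle : sampleLaw P K m (⋃ k, M k) ≤ ENNReal.ofReal (η / 4) := by
    refine (measure_iUnion_fintype_le _ _).trans ?_
    calc ∑ k, sampleLaw P K m (M k) ≤ ∑ _k : Fin K, ENNReal.ofReal (m * (γ / c) / (ε * (K * m))) :=
          Finset.sum_le_sum fun k _ => sampleLaw_testSet_error_le h k _ (by positivity)
      _ = ENNReal.ofReal (γ / (c * ε)) := by
          rw [Finset.sum_const, Finset.card_univ, Fintype.card_fin, nsmul_eq_mul,
            ← ENNReal.ofReal_natCast, ← ENNReal.ofReal_mul hK0.le]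
          congr 1; field_simp
      _ ≤ _ := by
          refine ENNReal.ofReal_le_ofReal ?_
          rw [div_le_iff₀ (by positivity)]
          linarith
  have hp_le : L ^ 2 * p / m ≤ α * η / 8 := by
    rw [div_le_iff₀ hm0]
    calc L ^ 2 * p ≤ L ^ 2 * (α * η / (8 * L ^ 2) * m) := by
          gcongr; exact hpm.trans (by gcongr; exact min_le_right _ _)
      _ = _ := by field_simp
  refine ⟨N ∪ ⋃ k, M k, ?_, fun d hd k a ha => ?_⟩
  · refine (measure_union_le _ _).trans ((add_le_add hN hMle).trans ?_)
    have t1 : ENNReal.ofReal (2 * (η / 8)) = ENNReal.ofReal (η / 4) := by congr 1; ring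
    have t2 : ENNReal.ofReal (2 * (L ^ 2 * p / m + tailBound r τ s L) / α)
        ≤ ENNReal.ofReal (3 / 8 * η) := by
      refine ENNReal.ofReal_le_ofReal ?_
      rw [div_le_iff₀ hα]; linarith
    have t3 : ENNReal.ofReal (2 * tailBound r τ s L / α) ≤ ENNReal.ofReal (1 / 8 * η) := by
      refine ENNReal.ofReal_le_ofReal ?_
      rw [div_le_iff₀ hα]; linarith
    rw [t1]
    -- The budget is 1/4 + 3/8 + 1/8 + 1/4 = 1 times η.
    refine (add_le_add_left (add_le_add (add_le_add_right t2 _) t3) _).trans (le_of_eq ?_)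
    rw [← ENNReal.ofReal_add (by positivity) (by positivity),
      ← ENNReal.ofReal_add (by positivity) (by positivity),
      ← ENNReal.ofReal_add (by positivity) (by positivity)]
    congr 1; ring
  · simp only [Set.mem_union, Set.mem_iUnion, not_or, not_exists] at hd
    obtain ⟨hd1, hd2⟩ := hNc d hd.1
    have h1 := norm_sq_le_of_controlled hK hm hc hγ hd1 k (hd2 k) (hd.2 k) ha
    refine ⟨h1.1.trans ?_, fun a' ha' => (h1.2 a' ha').trans ?_⟩
    · rw [div_le_iff₀ hc]; nlinarith [mul_pos hc hδ]
    · rw [div_le_iff₀ hc, hε_def]; nlinarith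

/-! ### Reduction to isotropic designs -/

section Whitening

variable {p : ℕ}

/-- A change of coordinates that makes the design isotropic. -/
theorem exists_whitening {P : Measure (Obs p)} (hx : MemLp (fun z : Obs p => z.1) 2 P) {c : ℝ}
    (hc : 0 < c) (hcov : ∀ v : EuclideanSpace ℝ (Fin p),
      c * ‖v‖ ^ 2 ≤ ∫ z, (inner ℝ z.1 v) ^ 2 ∂P) :
    ∃ S : EuclideanSpace ℝ (Fin p) ≃ₗ[ℝ] EuclideanSpace ℝ (Fin p),
      ∀ a, ∫ z, (inner ℝ z.1 (S a)) ^ 2 ∂P = ‖a‖ ^ 2 := by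
  have hmem : ∀ v : EuclideanSpace ℝ (Fin p), MemLp (fun z : Obs p => (inner ℝ z.1 v : ℝ)) 2 P :=
    fun v => hx.inner_const v
  -- The map v ↦ ⟨x, v⟩ into L² is injective by the eigenvalue bound; an orthonormal basis of its
  -- range, pulled back, provides S.
  set T : EuclideanSpace ℝ (Fin p) →ₗ[ℝ] Lp ℝ 2 P :=
    { toFun := fun v => (hmem v).toLp _
      map_add' := fun v w => by
        rw [← MemLp.toLp_add]
        congr 1
        ext z
        simp [inner_add_right]
      map_smul' := fun t v => by
        rw [RingHom.id_apply, ← MemLp.toLp_const_smul]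
        congr 1
        ext z
        simp [inner_smul_right] } with hT
  have hnorm : ∀ v, ‖T v‖ ^ 2 = ∫ z, (inner ℝ z.1 v) ^ 2 ∂P := fun v => by
    rw [← real_inner_self_eq_norm_sq, L2.inner_def]
    refine integral_congr_ae ?_
    filter_upwards [(hmem v).coeFn_toLp] with z hz
    have : (T v : Obs p → ℝ) z = inner ℝ z.1 v := hz
    rw [this]
    simp [sq]
  have hinj : Function.Injective T := by
    rw [← LinearMap.ker_eq_bot, LinearMap.ker_eq_bot']
    intro v hv
    have h1 := hcov v
    rw [← hnorm, hv, norm_zero] at h1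
    by_contra h0
    have : 0 < ‖v‖ := norm_pos_iff.mpr h0
    have : 0 < c * ‖v‖ ^ 2 := by positivity
    norm_num at h1
    linarith
  have hrank : Module.finrank ℝ (LinearMap.range T) = p := by
    rw [LinearMap.finrank_range_of_inj hinj, finrank_euclideanSpace_fin]
  set e := (stdOrthonormalBasis ℝ (LinearMap.range T)).reindex (finCongr hrank)
  set R := LinearEquiv.ofInjective T hinj
  refine ⟨e.repr.symm.toLinearEquiv.trans R.symm, fun a => ?_⟩
  rw [← hnorm]
  have h1 : T (R.symm (e.repr.symm a)) = (e.repr.symm a : Lp ℝ 2 P) :=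
    congrArg Subtype.val (R.apply_symm_apply (e.repr.symm a))
  have h2 : ‖T (R.symm (e.repr.symm a))‖ = ‖a‖ := by
    rw [h1]
    exact e.repr.symm.norm_map a
  exact congrArg (· ^ 2) h2

/-- The observation in the new coordinates, with the noise as response. -/
def whiten (S : EuclideanSpace ℝ (Fin p) ≃ₗ[ℝ] EuclideanSpace ℝ (Fin p))
    (β : EuclideanSpace ℝ (Fin p)) (z : Obs p) : Obs p :=
  (LinearMap.adjoint S.toLinearMap z.1, z.2 - inner ℝ z.1 β)

variable (S : EuclideanSpace ℝ (Fin p) ≃ₗ[ℝ] EuclideanSpace ℝ (Fin p))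
  (β : EuclideanSpace ℝ (Fin p))

theorem measurable_whiten : Measurable (whiten S β) := by
  have h := (LinearMap.continuous_of_finiteDimensional (LinearMap.adjoint S.toLinearMap)).measurable
  exact (h.comp measurable_fst).prodMk (by fun_prop)

theorem inner_whiten (z : Obs p) (a : EuclideanSpace ℝ (Fin p)) :
    (inner ℝ (whiten S β z).1 a : ℝ) = inner ℝ z.1 (S a) :=
  LinearMap.adjoint_inner_left S.toLinearMap a z.1

/-- Coefficient a in the new coordinates stands for β + S a in the old ones, so the true parameter
becomes 0 and every risk is unchanged. -/
theorem residual_whiten (z : Obs p) (a : EuclideanSpace ℝ (Fin p)) :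
    (whiten S β z).2 - inner ℝ (whiten S β z).1 a = z.2 - inner ℝ z.1 (β + S a) := by
  rw [inner_whiten, inner_add_right, whiten]; ring

theorem loss_whiten (z : Obs p) (a : EuclideanSpace ℝ (Fin p)) :
    loss a (whiten S β z) = loss (β + S a) z := by
  rw [loss, residual_whiten, loss]

theorem popRisk_map_whiten (P : Measure (Obs p)) (a : EuclideanSpace ℝ (Fin p)) :
    popRisk (P.map (whiten S β)) a = popRisk P (β + S a) := by
  rw [popRisk, integral_map (measurable_whiten S β).aemeasurable
    (Isotropic.measurable_loss a).aestronglyMeasurable]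
  simp_rw [loss_whiten]
  rfl

theorem empRisk_whiten {ι : Type*} [Fintype ι] (D : ι → Obs p) (a : EuclideanSpace ℝ (Fin p)) :
    empRisk (fun i => whiten S β (D i)) a = empRisk D (β + S a) := by
  simp_rw [empRisk_eq, residual_whiten]

theorem cvError_whiten {K m : ℕ} (d : Fin K × Fin m → Obs p) (a : EuclideanSpace ℝ (Fin p)) :
    cvError (fun i => whiten S β (d i)) a = cvError d (β + S a) := by
  simp_rw [cvError_eq, residual_whiten]

/-- Exogeneity gives orthogonality of noise and covariates, and S gives the identity covariance. As
a ↦ β + S a covers only coefficient vectors, the moment comparison is inherited; taking max τ 1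
secures a constant of at least 1. -/
theorem isotropic_whiten {P : Measure (Obs p)} {β : EuclideanSpace ℝ (Fin p)}
    (hP : LinearDGP P β) {r τ s : ℝ} (hr : 1 < r) (hτ : LossRatioBound P r τ)
    (hs : popRisk P β ≤ s) (hS : ∀ a, ∫ z, (inner ℝ z.1 (S a)) ^ 2 ∂P = ‖a‖ ^ 2) :
    Isotropic (P.map (whiten S β)) r (max τ 1) s := by
  have := hP.isProb
  have hφ := measurable_whiten S β
  have hxv : ∀ v, MemLp (fun z : Obs p => (inner ℝ z.1 v : ℝ)) 2 P :=
    fun v => hP.memLp_x.inner_const v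
  have hu : MemLp (fun z : Obs p => z.2 - inner ℝ z.1 β) 2 P := hP.memLp_y.sub (hxv β)
  have hint : ∀ {f : Obs p → ℝ}, Measurable f →
      ∫ z, f z ∂(P.map (whiten S β)) = ∫ z, f (whiten S β z) ∂P := fun hf =>
    integral_map hφ.aemeasurable hf.aestronglyMeasurable
  refine ⟨Measure.isProbabilityMeasure_map hφ.aemeasurable, ?_, ?_, fun v => ?_, fun v => ?_, hr,
    le_max_right _ _, fun b => ?_, ?_⟩
  · rw [memLp_map_measure_iff (by fun_prop) hφ.aemeasurable]
    exact (LinearMap.toContinuousLinearMap (LinearMap.adjoint S.toLinearMap)).comp_memLp'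
      hP.memLp_x
  · rw [memLp_map_measure_iff (by fun_prop) hφ.aemeasurable]
    exact hu
  · rw [hint (by fun_prop)]
    simp_rw [inner_whiten]
    have h1 : ∀ z : Obs p, (whiten S β z).2 * inner ℝ z.1 (S v)
        = ∑ j, (z.2 - inner ℝ z.1 β) * z.1 j * (S v) j := fun z => by
      simp only [whiten, PiLp.inner_apply, Finset.mul_sum]
      refine Finset.sum_congr rfl fun j _ => ?_
      simp; ring
    simp_rw [h1]
    have hxj : ∀ j, MemLp (fun z : Obs p => z.1 j) 2 P := fun j =>
      (EuclideanSpace.proj (𝕜 := ℝ) j).comp_memLp' hP.memLp_x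
    have hint' : ∀ j, Integrable (fun z : Obs p => (z.2 - inner ℝ z.1 β) * z.1 j) P :=
      fun j => hu.integrable_mul (hxj j)
    rw [integral_finsetSum _ fun j _ => (hint' j).mul_const _]
    refine Finset.sum_eq_zero fun j _ => ?_
    rw [integral_mul_const, hP.exogenous, zero_mul]
  · rw [hint (by fun_prop)]
    simp_rw [inner_whiten]
    exact hS v
  · rw [eLpNorm_map_measure (Isotropic.measurable_loss b).aestronglyMeasurable hφ.aemeasurable,
      popRisk_map_whiten]
    have h1 : loss b ∘ whiten S β = loss (β + S b) := funext fun z => loss_whiten S β z b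
    rw [h1]
    refine (hτ _).trans ?_
    gcongr
    exact le_max_left _ _
  · rw [hint (by fun_prop)]
    exact hs

theorem measurePreserving_whiten (P : Measure (Obs p)) [IsProbabilityMeasure P] (K m : ℕ) :
    MeasurePreserving (fun (d : Fin K × Fin m → Obs p) i => whiten S β (d i)) (sampleLaw P K m)
      (sampleLaw (P.map (whiten S β)) K m) := by
  have : IsProbabilityMeasure (P.map (whiten S β)) :=
    Measure.isProbabilityMeasure_map (measurable_whiten S β).aemeasurable
  exact measurePreserving_pi _ _ fun _ => (measurable_whiten S β).measurePreserving P

end Whitening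

/-- Consistency with uniform constants, as soon as the ratio of dimension to fold size is small. -/
theorem exists_consistency {r c δ η : ℝ} (τ s : ℝ) (hr : 1 < r) (hc : 0 < c) (hδ : 0 < δ)
    (hη : 0 < η) :
    ∃ κ > 0, ∀ (p K m : ℕ) (P : Measure (Obs p)) (β : EuclideanSpace ℝ (Fin p)),
      2 ≤ K → 1 ≤ m → (p : ℝ) ≤ κ * m → LinearDGP P β → LossRatioBound P r τ →
      popRisk P β ≤ s →
      (∀ v : EuclideanSpace ℝ (Fin p), c * ‖v‖ ^ 2 ≤ ∫ z, (inner ℝ z.1 v) ^ 2 ∂P) →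
      ∃ N : Set (Fin K × Fin m → Obs p), sampleLaw P K m N ≤ ENNReal.ofReal η ∧
        ∀ d ∉ N, ∀ k b, IsOLS (trainSet d k) b →
          ‖b - β‖ < δ ∧ ∀ b', cvError d b' ≤ cvError d b → ‖b' - β‖ < δ := by
  obtain ⟨κ, hκ, hiso⟩ := exists_isotropic_consistency (s := s) hr (le_max_right τ 1)
    (δ := c * δ ^ 2 / 4) (by positivity) hη
  refine ⟨κ, hκ, fun p K m P β hK hm hpm hP hτ hs hcov => ?_⟩
  have := hP.isProb
  rcases Nat.eq_zero_or_pos p with hp | hp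
  · subst hp
    refine ⟨∅, by simp, fun d _ k b _ => ⟨?_, fun b' _ => ?_⟩⟩
    · rwa [Subsingleton.elim (b - β) 0, norm_zero]
    · rwa [Subsingleton.elim (b' - β) 0, norm_zero]
  obtain ⟨S, hS⟩ := exists_whitening hP.memLp_x hc hcov
  obtain ⟨N, hN, hNd⟩ := hiso p K m _ hp hK hm hpm (isotropic_whiten S hP hr hτ hs hS)
  have hmp := measurePreserving_whiten S β P K m
  refine ⟨(fun d i => whiten S β (d i)) ⁻¹' N, ?_, fun d hd k b hb => ?_⟩
  -- N need not be measurable; this inequality for the outer measure suffices.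
  · refine (Measure.le_map_apply hmp.measurable.aemeasurable N).trans ?_
    rwa [hmp.map_eq]
  have hβ : ∀ b, β + S (S.symm (b - β)) = b := fun b => by
    rw [S.apply_symm_apply, add_sub_cancel]
  -- The whitened norm is the L² norm of ⟨x, b - β⟩, which dominates √c ‖b - β‖; this explains the
  -- tolerance c δ² / 4.
  have hnorm : ∀ b, ‖S.symm (b - β)‖ ^ 2 ≤ c * δ ^ 2 / 4 → ‖b - β‖ < δ := fun b hb => by
    have h1 := hcov (S (S.symm (b - β)))
    rw [hS, S.apply_symm_apply] at h1
    refine lt_of_pow_lt_pow_left₀ 2 hδ.le ?_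
    have h2 : ‖b - β‖ ^ 2 ≤ δ ^ 2 / 4 := le_of_mul_le_mul_left (by linarith) hc
    nlinarith [sq_pos_of_pos hδ]
  have hols : IsOLS (trainSet (fun i => whiten S β (d i)) k) (S.symm (b - β)) := by
    intro a
    have h1 := hb (β + S a)
    rw [← empRisk_whiten S β, ← hβ b, ← empRisk_whiten S β] at h1
    exact h1
  obtain ⟨h1, h2⟩ := hNd _ hd k _ hols
  refine ⟨hnorm b h1, fun b' hb' => hnorm b' (h2 _ ?_)⟩
  rwa [cvError_whiten, cvError_whiten, hβ, hβ]

theorem min_trainSize {K m : ℕ} (hK : 2 ≤ K) : min m (trainSize K m) = m :=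
  min_eq_left (Nat.le_mul_of_pos_left m (by omega))

end CVLasso

end

/-! ### The bound and the consistency statement -/

theorem corollary3 :
    -- the finite-sample bound
    (∀ (p K m : ℕ) (P : Measure (CVLasso.Obs p)) (β : EuclideanSpace ℝ (Fin p))
      (r τ ϖ : ℝ) (Pen : Set ℝ),
      2 ≤ K → 1 ≤ m → p ≤ CVLasso.trainSize K m →
      CVLasso.LinearDGP P β →
      1 < r → CVLasso.LossRatioBound P r τ → 0 < τ →
      0 < ϖ → ϖ < 1 →
      (0 : ℝ) ∈ Pen → (∀ pen ∈ Pen, 0 ≤ pen) →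
      ∃ G : Set (Fin K × Fin m → CVLasso.Obs p), MeasurableSet G ∧
        ENNReal.ofReal (ϖ * (1 - 1 / (CVLasso.trainSize K m : ℝ))) ≤
          CVLasso.sampleLaw P K m G ∧
        ∀ d ∈ G, 0 < CVLasso.rhoBar d →
          ∀ (bt : Fin K → EuclideanSpace ℝ (Fin p)) (ks qs : Fin K) (T : Set (Fin K))
            (bLasso : EuclideanSpace ℝ (Fin p)),
            CVLasso.IsWorstCase d bt ks qs → ks ∈ T → CVLasso.IsCVLasso d Pen T bLasso →
            (T = {ks} ∨ CVLasso.l1Norm bLasso ≤ CVLasso.l1Norm (bt ks)) →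
            1 / (K : ℝ) * ∑ _q : Fin K, ‖bt ks - bLasso‖ ^ 2 ≤
              CVLasso.cvBound P r τ ϖ d qs (bt ks)) ∧
    -- consistency of the OLS estimator and of the cross-validated Lasso
    (∀ (p K m : ℕ → ℕ) (P : (n : ℕ) → Measure (CVLasso.Obs (p n)))
      (β : (n : ℕ) → EuclideanSpace ℝ (Fin (p n))) (Pen : ℕ → Set ℝ) (r τ s c : ℝ),
      (∀ n, 2 ≤ K n) → (∀ n, 1 ≤ m n) →
      (∀ n, CVLasso.LinearDGP (P n) (β n)) →
      1 < r → (∀ n, CVLasso.LossRatioBound (P n) r τ) →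
      (∀ n, CVLasso.popRisk (P n) (β n) ≤ s) →
      0 < c → (∀ n, ∀ v : EuclideanSpace ℝ (Fin (p n)),
        c * ‖v‖ ^ 2 ≤ ∫ z, (inner ℝ z.1 v) ^ 2 ∂(P n)) →
      (∀ n, (0 : ℝ) ∈ Pen n) → (∀ n, ∀ pen ∈ Pen n, 0 ≤ pen) →
      Tendsto (fun n => (p n : ℝ) / (min (m n) (CVLasso.trainSize (K n) (m n)) : ℕ))
        atTop (𝓝 0) →
      ∀ δ : ℝ, 0 < δ →
        Tendsto (fun n => CVLasso.sampleLaw (P n) (K n) (m n)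
          {d | ∃ bt ks qs, CVLasso.IsWorstCase d bt ks qs ∧ δ ≤ ‖bt ks - β n‖})
          atTop (𝓝 0) ∧
        Tendsto (fun n => CVLasso.sampleLaw (P n) (K n) (m n)
          {d | ∃ bt ks qs T bLasso, CVLasso.IsWorstCase d bt ks qs ∧ ks ∈ T ∧
            CVLasso.IsCVLasso d (Pen n) T bLasso ∧ δ ≤ ‖bLasso - β n‖})
          atTop (𝓝 0)) := by
  refine ⟨fun p K m P β r τ ϖ Pen hK hm _ hP _ _ hτ hϖ0 hϖ1 h0 hPen => ?_, ?_⟩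
  · have := hP.isProb
    -- The bound holds for every sample with positive `rhoBar`, so the event is the whole space.
    refine ⟨Set.univ, MeasurableSet.univ, ?_, fun d _ hρ bt ks qs T bL hw hks hL hT => ?_⟩
    · rw [measure_univ, ENNReal.ofReal_le_one]
      have h1 : (0 : ℝ) ≤ 1 / (CVLasso.trainSize K m : ℝ) := by positivity
      nlinarith
    · have hK0 : (K : ℝ) ≠ 0 := by exact_mod_cast (by omega : K ≠ 0)
      rw [Finset.sum_const, Finset.card_univ, Fintype.card_fin, nsmul_eq_mul, ← mul_assoc,
        one_div_mul_cancel hK0, one_mul]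
      exact CVLasso.norm_sq_le_cvBound hK hm hτ hϖ1 h0 hPen hρ hw hks hL hT
  · intro p K m P β Pen r τ s c hK hm hP hr hτ hs hc hcov h0 _ hlim δ hδ
    -- The exceptional set is chosen before k and the estimators, so it covers data-dependent `ks`
    -- and every choice of minimizers.
    have key : ∀ ε : ENNReal, 0 < ε → ∀ᶠ n in atTop,
        ∃ N : Set (Fin (K n) × Fin (m n) → CVLasso.Obs (p n)),
          CVLasso.sampleLaw (P n) (K n) (m n) N ≤ ε ∧
          ∀ d ∉ N, ∀ k b, CVLasso.IsOLS (CVLasso.trainSet d k) b →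
            ‖b - β n‖ < δ ∧
              ∀ b', CVLasso.cvError d b' ≤ CVLasso.cvError d b → ‖b' - β n‖ < δ := by
      intro ε hε
      obtain ⟨η, hη0, hηε⟩ := ENNReal.lt_iff_exists_nnreal_btwn.mp hε
      have hη : (0 : ℝ) < η := by exact_mod_cast hη0
      obtain ⟨κ, hκ, hcons⟩ := CVLasso.exists_consistency τ s hr hc hδ hη
      filter_upwards [hlim.eventually_lt_const hκ] with n hn
      have hm0 : (0 : ℝ) < m n := by exact_mod_cast hm n
      rw [CVLasso.min_trainSize (hK n), div_lt_iff₀ hm0] at hn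
      obtain ⟨N, hN, hNd⟩ := hcons (p n) (K n) (m n) (P n) (β n) (hK n) (hm n) hn.le (hP n) (hτ n)
        (hs n) (hcov n)
      rw [ENNReal.ofReal_coe_nnreal] at hN
      exact ⟨N, hN.trans hηε.le, hNd⟩
    constructor <;> rw [ENNReal.tendsto_nhds_zero] <;> intro ε hε <;>
      filter_upwards [key ε hε] with n hn <;> obtain ⟨N, hN, hNd⟩ := hn <;>
      refine (measure_mono fun d hd => ?_).trans hN
    · obtain ⟨bt, ks, qs, hw, hle⟩ := hd
      by_contra hdN
      exact absurd (hNd d hdN ks _ (hw.1 ks)).1 (not_lt.mpr hle)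
    · obtain ⟨bt, ks, qs, T, bL, hw, hks, hL, hle⟩ := hd
      by_contra hdN
      exact absurd ((hNd d hdN ks _ (hw.1 ks)).2 bL (hL.cvError_le hw hks (h0 n)))
        (not_lt.mpr hle)
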